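/- All polytopes are convex, nonempty, and considered up to combinatorial equivalence. Let $\mathcal P$ be the ring of simple polytopes: the free abelian group on the combinatorial types of simple polytopes (formal addition being disjoint union), with multiplication the direct product and with unit the point; let $d$ be the derivation of $\mathcal P$ that sends a polytope to the sum of all its facets. Extend $d$ to $(\mathcal P\otimes\mathbb Q)[[x,y]]$ coefficientwise. For a finite simple graph $\Gamma$ with node set $V$, the graphical nestohedron of $\Gamma$ is the Minkowski sum in $\mathbb R^V$ of the simplices $\mathrm{conv}\{e_i : i\in S\}$ over all nonempty $S\subseteq V$ whose induced subgraph is connected. Let $Pe^n$ (the permutohedron) be the nestohedron of the complete graph on $n+1$ nodes, and let $P_{\nabla,\because}^{k,l}$ be the nestohedron of the join of the complete graph on $k$ nodes and the graph with $l$ nodes and no edges (the join being the disjoint union of the two graphs with all edges between them added). Put $$Pe(z)=\sum_{n\ge 0} Pe^n\,\frac{z^{n+1}}{(n+1)!},\qquad P_{\nabla,\because}(x,y)=\sum_{k\ge 1}\sum_{l\ge 0} P_{\nabla,\because}^{k,l}\,\frac{x^k}{k!}\frac{y^l}{l!}.$$ Then all the polytopes $Pe^n$ ($n\ge 0$) and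 $P_{\nabla,\because}^{k,l}$ ($k\ge 1$, $l\ge 0$) are simple, and in $(\mathcal P\otimes\mathbb Q)[[x,y]]$ $$d P_{\nabla,\because}(x,y)=P_{\nabla,\because}(x,y)\,\bigl(y+Pe(x+y)\bigr).$$ -/

import Mathlib

open scoped Pointwise Nat

/-- A (nonempty) convex polytope: the convex hull of a finite nonempty set of points in some
coordinate space `ℝ^ι` with `ι` finite. -/
structure Polytope : Type 1 where
  ι : Type
  finite : Finite ι
  carrier : Set (ι → ℝ)
  exists_points : ∃ S : Finset (ι → ℝ), S.Nonempty ∧ carrier = convexHull ℝ (S : Set (ι → ℝ))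

namespace Polytope

theorem convex (P : Polytope) : Convex ℝ P.carrier := by
  obtain ⟨S, -, h⟩ := P.exists_points
  rw [h]; exact convex_convexHull ℝ _

theorem nonempty (P : Polytope) : P.carrier.Nonempty := by
  obtain ⟨S, hS, h⟩ := P.exists_points
  rw [h]; exact (convexHull_nonempty_iff).2 hS

/-- The nonempty faces of a polytope `P` (including `P` itself), ordered by inclusion.
A face is a convex subset `F` of `P` such that whenever a point of `F` lies in the open segment
between two points of `P`, these two points are in `F`. -/
def Face (P : Polytope) : Type :=
  {F : Set (P.ι → ℝ) // F.Nonempty ∧ Convex ℝ F ∧ IsExtreme ℝ P.carrier F}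

instance (P : Polytope) : PartialOrder P.Face :=
  inferInstanceAs (PartialOrder
    {F : Set (P.ι → ℝ) // F.Nonempty ∧ Convex ℝ F ∧ IsExtreme ℝ P.carrier F})

/-- The polytope itself is its largest face. -/
instance (P : Polytope) : OrderTop P.Face where
  top := ⟨P.carrier, P.nonempty, P.convex, IsExtreme.refl ℝ _⟩
  le_top F := F.2.2.2.subset

/-- A face of the convex hull of a finite set is the hull of the points it contains. -/
theorem Face.eq_convexHull (P : Polytope) (S : Finset (P.ι → ℝ))
    (hS : P.carrier = convexHull ℝ (S : Set (P.ι → ℝ))) (F : P.Face) :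
    F.1 = convexHull ℝ ((S : Set (P.ι → ℝ)) ∩ F.1) := by
  obtain ⟨F, hne, hconv, hext⟩ := F
  apply Set.Subset.antisymm
  · intro x hx
    change x ∈ F at hx
    change x ∈ convexHull ℝ ((S : Set (P.ι → ℝ)) ∩ F)
    have hSP : (S : Set (P.ι → ℝ)) ⊆ P.carrier := hS ▸ subset_convexHull ℝ _
    have hB : convexHull ℝ ((S : Set (P.ι → ℝ)) \ F) ⊆ P.carrier \ F :=
      convexHull_min (Set.sdiff_subset_sdiff_left hSP) (hext.convex_sdiff P.convex)
    have hA : convexHull ℝ ((S : Set (P.ι → ℝ)) ∩ F) ⊆ F :=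
      convexHull_min Set.inter_subset_right hconv
    have hxS : x ∈ convexHull ℝ (((S : Set (P.ι → ℝ)) ∩ F) ∪ ((S : Set (P.ι → ℝ)) \ F)) := by
      rw [Set.inter_union_sdiff, ← hS]; exact hext.subset hx
    rcases Set.eq_empty_or_nonempty ((S : Set (P.ι → ℝ)) ∩ F) with hAe | hAn
    · rw [hAe, Set.empty_union] at hxS
      exact absurd hx (hB hxS).2
    rcases Set.eq_empty_or_nonempty ((S : Set (P.ι → ℝ)) \ F) with hBe | hBn
    · rwa [hBe, Set.union_empty] at hxS
    rw [convexHull_union hAn hBn, mem_convexJoin] at hxS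
    obtain ⟨a, ha, b, hb, hab⟩ := hxS
    have hb' := hB hb
    rw [← insert_endpoints_openSegment] at hab
    rcases hab with rfl | rfl | hab
    · exact ha
    · exact absurd hx hb'.2
    · exact absurd (hext.right_mem_of_mem_openSegment (hext.subset (hA ha)) hb'.1 hx hab) hb'.2
  · exact convexHull_min Set.inter_subset_right hconv

instance (P : Polytope) : Finite P.Face := by
  obtain ⟨S, -, hS⟩ := P.exists_points
  have := (S.finite_toSet.finite_subsets).to_subtype
  refine Finite.of_injective
    (fun F : P.Face => (⟨(S : Set (P.ι → ℝ)) ∩ F.1, Set.inter_subset_left⟩ :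
      {T : Set (P.ι → ℝ) | T ⊆ (S : Set (P.ι → ℝ))})) ?_
  intro F G h
  have h' : (S : Set (P.ι → ℝ)) ∩ F.1 = (S : Set (P.ι → ℝ)) ∩ G.1 := congrArg Subtype.val h
  apply Subtype.ext
  rw [Face.eq_convexHull P S hS F, Face.eq_convexHull P S hS G, h']

/-- A face of a polytope, regarded as a polytope. -/
def Face.toPolytope {P : Polytope} (F : P.Face) : Polytope where
  ι := P.ι
  finite := P.finite
  carrier := F.1
  exists_points := by
    classical
    obtain ⟨S, -, hS⟩ := P.exists_points
    have h := Face.eq_convexHull P S hS F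
    refine ⟨S.filter (· ∈ F.1), ?_, ?_⟩
    · rw [← Finset.coe_nonempty, ← convexHull_nonempty_iff (𝕜 := ℝ)]
      have : ((S.filter (· ∈ F.1) : Finset _) : Set (P.ι → ℝ)) = (S : Set (P.ι → ℝ)) ∩ F.1 := by
        ext; simp
      rw [this, ← h]; exact F.2.1
    · have : ((S.filter (· ∈ F.1) : Finset _) : Set (P.ι → ℝ)) = (S : Set (P.ι → ℝ)) ∩ F.1 := by
        ext; simp
      rw [this, ← h]

/-- The facets of a polytope: its maximal proper faces. -/
def Facet (P : Polytope) : Type := {F : P.Face // IsCoatom F}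

instance (P : Polytope) : Finite P.Facet :=
  inferInstanceAs (Finite {F : P.Face // IsCoatom F})

/-- The dimension of a polytope, that is, of its affine span. -/
noncomputable def dim (P : Polytope) : ℕ := Module.finrank ℝ (vectorSpan ℝ P.carrier)

/-- A polytope is simple if each vertex lies in exactly `dim P` facets. -/
def IsSimple (P : Polytope) : Prop :=
  ∀ v ∈ P.carrier.extremePoints ℝ, {F : P.Facet | v ∈ F.1.1}.ncard = P.dim

/-- Combinatorial equivalence: isomorphism of the face posets. -/
instance setoid : Setoid Polytope where
  r P Q := Nonempty (P.Face ≃o Q.Face)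
  iseqv := ⟨fun _ => ⟨OrderIso.refl _⟩, fun ⟨e⟩ => ⟨e.symm⟩, fun ⟨e⟩ ⟨f⟩ => ⟨e.trans f⟩⟩

/-- The direct product `P × Q`, in `ℝ^(ι ⊔ κ) = ℝ^ι × ℝ^κ`. -/
def prod (P Q : Polytope) : Polytope where
  ι := P.ι ⊕ Q.ι
  finite := by have := P.finite; have := Q.finite; infer_instance
  carrier := {z | z ∘ Sum.inl ∈ P.carrier ∧ z ∘ Sum.inr ∈ Q.carrier}
  exists_points := by
    classical
    obtain ⟨S, hSn, hS⟩ := P.exists_points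
    obtain ⟨T, hTn, hT⟩ := Q.exists_points
    let e := (LinearEquiv.sumArrowLequivProdArrow P.ι Q.ι ℝ ℝ).symm
    refine ⟨(S ×ˢ T).image e, (hSn.product hTn).image _, ?_⟩
    rw [Finset.coe_image, Finset.coe_product]
    have h := (e : (P.ι → ℝ) × (Q.ι → ℝ) →ₗ[ℝ] (P.ι ⊕ Q.ι → ℝ)).image_convexHull
      ((S : Set (P.ι → ℝ)) ×ˢ (T : Set (Q.ι → ℝ)))
    rw [convexHull_prod, ← hS, ← hT] at h
    refine Eq.trans ?_ h
    ext z
    constructor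
    · rintro ⟨h1, h2⟩
      exact ⟨(z ∘ Sum.inl, z ∘ Sum.inr), ⟨h1, h2⟩, e.symm.injective (by simp [e]; rfl)⟩
    · rintro ⟨⟨a, b⟩, ⟨h1, h2⟩, rfl⟩
      exact ⟨h1, h2⟩

section ProdFaces

variable {P Q : Polytope}

theorem elim_openSegment {ι κ : Type} {a c x : ι → ℝ} {b d y : κ → ℝ} {s t : ℝ}
    (h1 : s • a + t • c = x) (h2 : s • b + t • d = y) :
    s • Sum.elim a b + t • Sum.elim c d = Sum.elim x y := by
  subst h1 h2
  ext (i | i) <;> simp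

/-- A face of a product is the product of its projections. -/
theorem Face.elim_mem (F : (P.prod Q).Face) {z w : P.ι ⊕ Q.ι → ℝ} (hz : z ∈ F.1) (hw : w ∈ F.1) :
    Sum.elim (z ∘ Sum.inl) (w ∘ Sum.inr) ∈ F.1 := by
  obtain ⟨F, hne, hconv, hext⟩ := F
  have hz' := hext.subset hz
  have hw' := hext.subset hw
  have hm : (2⁻¹ : ℝ) • z + (2⁻¹ : ℝ) • w ∈ F :=
    hconv hz hw (by norm_num) (by norm_num) (by norm_num)
  refine hext.left_mem_of_mem_openSegment (x := Sum.elim (z ∘ Sum.inl) (w ∘ Sum.inr))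
    (y := Sum.elim (w ∘ Sum.inl) (z ∘ Sum.inr)) ⟨hz'.1, hw'.2⟩ ⟨hw'.1, hz'.2⟩ hm ?_
  refine ⟨2⁻¹, 2⁻¹, by norm_num, by norm_num, by norm_num, ?_⟩
  have h : ∀ a b : ℝ, 2⁻¹ * a + 2⁻¹ * b = 2⁻¹ * b + 2⁻¹ * a := fun a b => add_comm _ _
  ext (i | i)
  · rfl
  · exact h _ _

/-- The nonempty faces of `P × Q` are the products of a nonempty face of `P` and one of `Q`. -/
def prodFaceIso (P Q : Polytope) : (P.prod Q).Face ≃o P.Face × Q.Face where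
  toFun F :=
    (⟨(fun z : P.ι ⊕ Q.ι → ℝ => z ∘ Sum.inl) '' F.1, F.2.1.image _,
      (F.2.2.1).is_linear_image (f := fun z : P.ι ⊕ Q.ι → ℝ => z ∘ Sum.inl)
        ⟨fun _ _ => rfl, fun _ _ => rfl⟩,
      { subset := by rintro _ ⟨z, hz, rfl⟩; exact (F.2.2.2.subset hz).1
        left_mem_of_mem_openSegment := by
          rintro x hx y hy _ ⟨z, hz, rfl⟩ ⟨s, t, hs, ht, hst, h⟩
          have hq := (F.2.2.2.subset hz).2
          refine ⟨Sum.elim x (z ∘ Sum.inr), ?_, rfl⟩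
          refine F.2.2.2.left_mem_of_mem_openSegment (x := Sum.elim x (z ∘ Sum.inr))
            (y := Sum.elim y (z ∘ Sum.inr)) ⟨hx, hq⟩ ⟨hy, hq⟩ hz ⟨s, t, hs, ht, hst, ?_⟩
          have := elim_openSegment h
            (show s • (z ∘ Sum.inr) + t • (z ∘ Sum.inr) = z ∘ Sum.inr by
              rw [← add_smul, hst, one_smul])
          exact this.trans (Sum.elim_comp_inl_inr z) }⟩,
     ⟨(fun z : P.ι ⊕ Q.ι → ℝ => z ∘ Sum.inr) '' F.1, F.2.1.image _,
      (F.2.2.1).is_linear_image (f := fun z : P.ι ⊕ Q.ι → ℝ => z ∘ Sum.inr)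
        ⟨fun _ _ => rfl, fun _ _ => rfl⟩,
      { subset := by rintro _ ⟨z, hz, rfl⟩; exact (F.2.2.2.subset hz).2
        left_mem_of_mem_openSegment := by
          rintro x hx y hy _ ⟨z, hz, rfl⟩ ⟨s, t, hs, ht, hst, h⟩
          have hq := (F.2.2.2.subset hz).1
          refine ⟨Sum.elim (z ∘ Sum.inl) x, ?_, rfl⟩
          refine F.2.2.2.left_mem_of_mem_openSegment (x := Sum.elim (z ∘ Sum.inl) x)
            (y := Sum.elim (z ∘ Sum.inl) y) ⟨hq, hx⟩ ⟨hq, hy⟩ hz ⟨s, t, hs, ht, hst, ?_⟩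
          have := elim_openSegment
            (show s • (z ∘ Sum.inl) + t • (z ∘ Sum.inl) = z ∘ Sum.inl by
              rw [← add_smul, hst, one_smul]) h
          exact this.trans (Sum.elim_comp_inl_inr z) }⟩)
  invFun FG := ⟨{z | z ∘ Sum.inl ∈ FG.1.1 ∧ z ∘ Sum.inr ∈ FG.2.1}, by
      obtain ⟨x, hx⟩ := FG.1.2.1
      obtain ⟨y, hy⟩ := FG.2.2.1
      exact ⟨Sum.elim x y, hx, hy⟩, by
      intro x hx y hy s t hs ht hst
      exact ⟨FG.1.2.2.1 hx.1 hy.1 hs ht hst, FG.2.2.2.1 hx.2 hy.2 hs ht hst⟩,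
      { subset := fun z hz => ⟨FG.1.2.2.2.subset hz.1, FG.2.2.2.2.subset hz.2⟩
        left_mem_of_mem_openSegment := by
          rintro x hx y hy z hz ⟨s, t, hs, ht, hst, rfl⟩
          exact ⟨FG.1.2.2.2.left_mem_of_mem_openSegment hx.1 hy.1 hz.1 ⟨s, t, hs, ht, hst, rfl⟩,
            FG.2.2.2.2.left_mem_of_mem_openSegment hx.2 hy.2 hz.2 ⟨s, t, hs, ht, hst, rfl⟩⟩ }⟩
  left_inv F := by
    apply Subtype.ext
    ext z
    constructor
    · rintro ⟨⟨a, ha, h1⟩, ⟨b, hb, h2⟩⟩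
      have := Face.elim_mem F ha hb
      have hz : Sum.elim (a ∘ Sum.inl) (b ∘ Sum.inr) = z := by
        ext (i | i)
        · exact congrFun h1 i
        · exact congrFun h2 i
      exact hz ▸ this
    · intro hz
      exact ⟨⟨z, hz, rfl⟩, ⟨z, hz, rfl⟩⟩
  right_inv FG := by
    obtain ⟨x, hx⟩ := FG.1.2.1
    obtain ⟨y, hy⟩ := FG.2.2.1
    refine Prod.ext (Subtype.ext ?_) (Subtype.ext ?_)
    · ext u
      constructor
      · rintro ⟨z, hz, rfl⟩; exact hz.1
      · intro hu; exact ⟨Sum.elim u y, ⟨hu, hy⟩, rfl⟩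
    · ext u
      constructor
      · rintro ⟨z, hz, rfl⟩; exact hz.2
      · intro hu; exact ⟨Sum.elim x u, ⟨hx, hu⟩, rfl⟩
  map_rel_iff' := by
    intro F G
    constructor
    · rintro ⟨h1, h2⟩ z hz
      obtain ⟨a, ha, h1⟩ := h1 ⟨z, hz, rfl⟩
      obtain ⟨b, hb, h2⟩ := h2 ⟨z, hz, rfl⟩
      have := Face.elim_mem G ha hb
      have hz : Sum.elim (a ∘ Sum.inl) (b ∘ Sum.inr) = z := by
        ext (i | i)
        · exact congrFun h1 i
        · exact congrFun h2 i
      exact hz ▸ this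
    · intro h
      exact ⟨Set.image_mono h, Set.image_mono h⟩

end ProdFaces

/-- The point, as a polytope in `ℝ^0`. -/
def point : Polytope where
  ι := Empty
  finite := inferInstance
  carrier := Set.univ
  exists_points := ⟨{0}, by simp, by
    rw [Finset.coe_singleton, convexHull_singleton]
    exact (Set.eq_univ_of_forall fun x => Subsingleton.elim x 0).symm⟩

instance : Unique point.Face where
  default := ⊤
  uniq F := by
    apply Subtype.ext
    obtain ⟨x, hx⟩ := F.2.1
    refine Set.Subset.antisymm (Set.subset_univ _) fun y _ => ?_
    have : y = x := funext fun i : Empty => i.elim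
    exact this ▸ hx

/-- The faces of a face `F` of `P` are the faces of `P` contained in `F`. -/
def faceIso {P : Polytope} (F : P.Face) : F.toPolytope.Face ≃o Set.Iic F where
  toFun G := ⟨⟨G.1, G.2.1, G.2.2.1, F.2.2.2.trans G.2.2.2⟩, G.2.2.2.subset⟩
  invFun G := ⟨G.1.1, G.1.2.1, G.1.2.2.1, G.1.2.2.2.mono F.2.2.2.subset G.2⟩
  left_inv _ := rfl
  right_inv _ := rfl
  map_rel_iff' := Iff.rfl

/-- An isomorphism of posets restricts to lower intervals. -/
def iicIso {α β : Type} [PartialOrder α] [PartialOrder β] (e : α ≃o β) (a : α) :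
    Set.Iic a ≃o Set.Iic (e a) where
  toFun x := ⟨e x.1, e.le_iff_le.2 x.2⟩
  invFun y := ⟨e.symm y.1, by
    have := e.symm.le_iff_le.2 y.2
    simpa using this⟩
  left_inv x := by simp
  right_inv y := by simp
  map_rel_iff' := e.le_iff_le

/-- The product of two isomorphisms of posets. -/
def prodIso {α β γ δ : Type} [PartialOrder α] [PartialOrder β] [PartialOrder γ] [PartialOrder δ]
    (e : α ≃o β) (f : γ ≃o δ) : α × γ ≃o β × δ where
  toEquiv := e.toEquiv.prodCongr f.toEquiv
  map_rel_iff' := by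
    rintro ⟨a, b⟩ ⟨c, d⟩
    exact and_congr e.le_iff_le f.le_iff_le

/-- A lower interval in a product of posets is a product of lower intervals. -/
def iicProdIso {α β : Type} [PartialOrder α] [PartialOrder β] (a : α × β) :
    Set.Iic a ≃o Set.Iic a.1 × Set.Iic a.2 where
  toFun x := (⟨x.1.1, x.2.1⟩, ⟨x.1.2, x.2.2⟩)
  invFun x := ⟨(x.1.1, x.2.1), ⟨x.1.2, x.2.2⟩⟩
  left_inv _ := rfl
  right_inv _ := rfl
  map_rel_iff' := Iff.rfl

end Polytope

/-- Combinatorial types of polytopes. -/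
def CombPolytope : Type 1 := Quotient Polytope.setoid

namespace CombPolytope

open Polytope

/-- The combinatorial types of polytopes form a commutative monoid under direct product,
with the point as unit. -/
noncomputable instance : CommMonoid CombPolytope where
  mul := Quotient.map₂ Polytope.prod (by
    rintro P P' ⟨e⟩ Q Q' ⟨f⟩
    exact ⟨(prodFaceIso P Q).trans ((prodIso e f).trans (prodFaceIso P' Q').symm)⟩)
  one := Quotient.mk _ point
  mul_assoc := by
    rintro ⟨P⟩ ⟨Q⟩ ⟨R⟩
    refine Quotient.sound ⟨(prodFaceIso _ R).trans ?_⟩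
    refine (prodIso (prodFaceIso P Q) (OrderIso.refl _)).trans ?_
    refine (OrderIso.prodAssoc _ _ _).trans ?_
    exact (prodIso (OrderIso.refl _) (prodFaceIso Q R).symm).trans (prodFaceIso P _).symm
  mul_comm := by
    rintro ⟨P⟩ ⟨Q⟩
    exact Quotient.sound ⟨(prodFaceIso P Q).trans
      (OrderIso.prodComm.trans (prodFaceIso Q P).symm)⟩
  one_mul := by
    rintro ⟨P⟩
    exact Quotient.sound ⟨(prodFaceIso _ P).trans
      { Equiv.uniqueProd P.Face point.Face with
        map_rel_iff' := by
          rintro ⟨a, b⟩ ⟨c, d⟩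
          exact ⟨fun h => ⟨(Subsingleton.elim a c).le, h⟩, fun h => h.2⟩ }⟩
  mul_one := by
    rintro ⟨P⟩
    exact Quotient.sound ⟨(prodFaceIso P _).trans
      { Equiv.prodUnique P.Face point.Face with
        map_rel_iff' := by
          rintro ⟨a, b⟩ ⟨c, d⟩
          exact ⟨fun h => ⟨h, (Subsingleton.elim b d).le⟩, fun h => h.1⟩ }⟩

end CombPolytope

/-- The ring of polytopes with rational coefficients: formal rational combinations of
combinatorial types of polytopes (formal addition is disjoint union), with multiplication
induced by the direct product. The combinatorial types of simple polytopes span the subring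
which is the ring of simple polytopes tensored with `ℚ`. -/
abbrev PolytopeRing : Type 1 := MonoidAlgebra ℚ CombPolytope

namespace Polytope

/-- The class `[P]` of a polytope in the ring of polytopes. -/
noncomputable def cls (P : Polytope) : PolytopeRing :=
  MonoidAlgebra.of ℚ CombPolytope (Quotient.mk _ P)

/-- The sum of the classes of all facets of `P` (a finite sum). -/
noncomputable def facetSum (P : Polytope) : PolytopeRing :=
  ∑ᶠ F : P.Facet, F.1.toPolytope.cls

theorem cls_eq_of_iso {P Q : Polytope} (e : P.Face ≃o Q.Face) : P.cls = Q.cls :=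
  congrArg (MonoidAlgebra.of ℚ CombPolytope) (Quotient.sound ⟨e⟩)

theorem facetSum_eq_of_iso {P Q : Polytope} (e : P.Face ≃o Q.Face) :
    P.facetSum = Q.facetSum :=
  finsum_eq_of_bijective
    (fun F : P.Facet => (⟨e F.1, (e.isCoatom_iff F.1).2 F.2⟩ : Q.Facet))
    (e.toEquiv.subtypeEquiv (fun F => (e.isCoatom_iff F).symm)).bijective
    (fun F => cls_eq_of_iso
      ((faceIso F.1).trans ((iicIso e F.1).trans (faceIso (P := Q) (e F.1)).symm)))

theorem cls_prod (P Q : Polytope) : (P.prod Q).cls = P.cls * Q.cls :=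
  (MonoidAlgebra.of ℚ CombPolytope).map_mul (Quotient.mk _ P) (Quotient.mk _ Q)

theorem facetSum_prod (P Q : Polytope) :
    (P.prod Q).facetSum = P.cls * Q.facetSum + Q.cls * P.facetSum := by
  classical
  have := Fintype.ofFinite P.Facet
  have := Fintype.ofFinite Q.Facet
  have hcoatom : ∀ (a : P.Face) (b : Q.Face),
      IsCoatom (a, b) ↔ (a = ⊤ ∧ IsCoatom b) ∨ (IsCoatom a ∧ b = ⊤) := by
    intro a b
    constructor
    · intro h
      by_cases ha : a = ⊤
      · subst ha
        refine Or.inl ⟨rfl, fun hb => h.1 (by rw [hb]; rfl), fun c hc => ?_⟩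
        exact congrArg Prod.snd (h.2 (⊤, c) (Prod.mk_lt_mk_iff_right.2 hc))
      · have hb : b = ⊤ := by
          by_contra hb
          have := h.2 (a, ⊤) (Prod.mk_lt_mk_iff_right.2 (lt_top_iff_ne_top.2 hb))
          exact ha (congrArg Prod.fst this)
        subst hb
        refine Or.inr ⟨⟨ha, fun c hc => ?_⟩, rfl⟩
        exact congrArg Prod.fst (h.2 (c, ⊤) (Prod.mk_lt_mk_iff_left.2 hc))
    · rintro (⟨rfl, hb⟩ | ⟨ha, rfl⟩)
      · refine ⟨fun h => hb.1 (congrArg Prod.snd h), ?_⟩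
        rintro ⟨c, d⟩ h
        have hc : c = ⊤ := top_le_iff.1 h.le.1
        subst hc
        rw [hb.2 d (Prod.mk_lt_mk_iff_right.1 h)]; rfl
      · refine ⟨fun h => ha.1 (congrArg Prod.fst h), ?_⟩
        rintro ⟨c, d⟩ h
        have hd : d = ⊤ := top_le_iff.1 h.le.2
        subst hd
        rw [ha.2 c (Prod.mk_lt_mk_iff_left.1 h)]; rfl
  let e := prodFaceIso P Q
  have hcls : ∀ (a : P.Face) (b : Q.Face),
      (e.symm (a, b)).toPolytope.cls = a.toPolytope.cls * b.toPolytope.cls := by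
    intro a b
    rw [← cls_prod]
    refine cls_eq_of_iso ?_
    refine (faceIso _).trans ((iicIso e.symm (a, b)).symm.trans ((iicProdIso _).trans ?_))
    exact (prodIso (faceIso a).symm (faceIso b).symm).trans (prodFaceIso _ _).symm
  let g : Q.Facet ⊕ P.Facet → (P.prod Q).Facet := Sum.elim
    (fun b => ⟨e.symm (⊤, b.1), (e.symm.isCoatom_iff _).2 ((hcoatom _ _).2 (Or.inl ⟨rfl, b.2⟩))⟩)
    (fun a => ⟨e.symm (a.1, ⊤), (e.symm.isCoatom_iff _).2 ((hcoatom _ _).2 (Or.inr ⟨a.2, rfl⟩))⟩)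
  have hg : Function.Bijective g := by
    constructor
    · rintro (b | a) (b' | a') h
      · have h' := e.symm.injective (congrArg Subtype.val h)
        exact congrArg Sum.inl (Subtype.ext (congrArg Prod.snd h'))
      · have h' := e.symm.injective (congrArg Subtype.val h)
        exact absurd (congrArg Prod.fst h').symm a'.2.1
      · have h' := e.symm.injective (congrArg Subtype.val h)
        exact absurd (congrArg Prod.fst h') a.2.1
      · have h' := e.symm.injective (congrArg Subtype.val h)
        exact congrArg Sum.inr (Subtype.ext (congrArg Prod.fst h'))
    · rintro ⟨F, hF⟩
      have h := (hcoatom (e F).1 (e F).2).1 ((e.isCoatom_iff F).2 hF)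
      rcases h with ⟨h1, h2⟩ | ⟨h1, h2⟩
      · refine ⟨Sum.inl ⟨_, h2⟩, Subtype.ext ?_⟩
        change e.symm (⊤, (e F).2) = F
        rw [← h1]; exact e.symm_apply_apply F
      · refine ⟨Sum.inr ⟨_, h1⟩, Subtype.ext ?_⟩
        change e.symm ((e F).1, ⊤) = F
        rw [← h2]; exact e.symm_apply_apply F
  have h1 : (P.prod Q).facetSum = ∑ᶠ x : Q.Facet ⊕ P.Facet,
      Sum.elim (fun b : Q.Facet => P.cls * b.1.toPolytope.cls)
        (fun a : P.Facet => Q.cls * a.1.toPolytope.cls) x := by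
    refine (finsum_eq_of_bijective g hg ?_).symm
    rintro (b | a)
    · exact (hcls ⊤ b.1).symm
    · exact (mul_comm _ _).trans (hcls a.1 ⊤).symm
  rw [h1, finsum_eq_sum_of_fintype, Fintype.sum_sum_type, facetSum, facetSum,
    finsum_eq_sum_of_fintype, finsum_eq_sum_of_fintype, Finset.mul_sum, Finset.mul_sum]
  rfl

end Polytope

/-- The facet sum of a combinatorial type. -/
noncomputable def CombPolytope.facetSum : CombPolytope → PolytopeRing :=
  Quotient.lift Polytope.facetSum fun _ _ ⟨e⟩ => Polytope.facetSum_eq_of_iso e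

/-- The derivation `d` of the ring of polytopes: the `ℚ`-linear map that sends the class of a
polytope `P` to the sum of the classes of all facets of `P`. -/
noncomputable def boundary : Derivation ℚ PolytopeRing PolytopeRing :=
  Derivation.mk' ((MonoidAlgebra.basis CombPolytope ℚ).constr ℚ CombPolytope.facetSum) (by
    have key : ∀ p : CombPolytope, (MonoidAlgebra.basis CombPolytope ℚ).constr ℚ
        CombPolytope.facetSum (MonoidAlgebra.single p 1) = p.facetSum := fun p => by
      rw [← MonoidAlgebra.basis_apply, Module.Basis.constr_basis]
    intro a b
    induction a using MonoidAlgebra.induction_linear with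
    | zero => simp
    | add a a' ha ha' => rw [add_mul, map_add, map_add, ha, ha']; simp only [smul_eq_mul]; ring
    | single p r =>
      induction b using MonoidAlgebra.induction_linear with
      | zero => simp
      | add b b' hb hb' => rw [mul_add, map_add, map_add, hb, hb']; simp only [smul_eq_mul]; ring
      | single q s =>
        have hs : ∀ (p : CombPolytope) (r : ℚ),
            (MonoidAlgebra.single p r : PolytopeRing) = r • MonoidAlgebra.single p 1 := by simp
        have hpq : (p * q).facetSum = MonoidAlgebra.single p 1 * q.facetSum +
            MonoidAlgebra.single q 1 * p.facetSum := by
          induction p using Quotient.inductionOn with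
          | h P =>
            induction q using Quotient.inductionOn with
            | h Q => exact Polytope.facetSum_prod P Q
        rw [MonoidAlgebra.single_mul_single, hs p r, hs q s, hs (p * q) (r * s)]
        simp only [map_smul, key, hpq, smul_eq_mul, smul_add, smul_mul_smul_comm]
        rw [mul_comm s r])

theorem boundary_cls (P : Polytope) : boundary P.cls = P.facetSum :=
  (MonoidAlgebra.basis CombPolytope ℚ).constr_basis ℚ CombPolytope.facetSum (Quotient.mk _ P)

/-- A building set on a finite set `V`: a family of nonempty subsets that contains all
singletons and contains `S ∪ T` whenever it contains `S` and `T` and these intersect. -/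
structure BuildingSet (V : Type) [Fintype V] [DecidableEq V] where
  sets : Finset (Finset V)
  nonempty_of_mem : ∀ S ∈ sets, S.Nonempty
  singleton_mem : ∀ v, {v} ∈ sets
  union_mem : ∀ S ∈ sets, ∀ T ∈ sets, (S ∩ T).Nonempty → S ∪ T ∈ sets

/-- The vertices `e_i`, `i ∈ S`, of the simplex `Δ_S`. -/
def simplexVertices {V : Type} [DecidableEq V] (S : Finset V) : Finset (V → ℝ) :=
  S.map ⟨fun i => Pi.single i (1 : ℝ), by
    intro i j h
    by_contra hij
    have := congrFun h i
    simp [hij] at this⟩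

/-- The nestohedron `P_B`: the Minkowski sum of the simplices `Δ_S = conv {e_i | i ∈ S}`
for `S ∈ B`. -/
noncomputable def BuildingSet.nestohedron {V : Type} [Fintype V] [DecidableEq V]
    (B : BuildingSet V) : Polytope where
  ι := V
  finite := inferInstance
  carrier := ∑ S ∈ B.sets, convexHull ℝ (simplexVertices S : Set (V → ℝ))
  exists_points := by
    classical
    refine ⟨∑ S ∈ B.sets, simplexVertices S, ?_, ?_⟩
    · have h : ∀ A : Finset (Finset V), (∀ S ∈ A, S.Nonempty) →
          (∑ S ∈ A, simplexVertices S).Nonempty := by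
        intro A
        induction A using Finset.induction_on with
        | empty => intro _; simp
        | insert S A hS ih =>
          intro h
          rw [Finset.sum_insert hS]
          exact ((h S (Finset.mem_insert_self _ _)).map).add
            (ih fun T hT => h T (Finset.mem_insert_of_mem hT))
      exact h _ B.nonempty_of_mem
    · rw [Finset.coe_sum, convexHull_sum]

open Classical in
/-- The graphical building set `B(Γ)`: all nonempty sets of nodes whose induced subgraph is
connected. -/
noncomputable def SimpleGraph.buildingSet {V : Type} [Fintype V] [DecidableEq V]
    (G : SimpleGraph V) : BuildingSet V where
  sets := {S : Finset V | S.Nonempty ∧ (G.induce (S : Set V)).Connected}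
  nonempty_of_mem S hS := by simp at hS; exact hS.1
  singleton_mem v := by
    simp only [Finset.mem_filter, Finset.mem_univ, true_and, Finset.singleton_nonempty]
    have h1 : Subsingleton (({v} : Finset V) : Set V) :=
      ⟨fun a b => Subtype.ext ((Finset.mem_singleton.1 a.2).trans (Finset.mem_singleton.1 b.2).symm)⟩
    have h2 : Nonempty (({v} : Finset V) : Set V) := ⟨⟨v, Finset.mem_singleton_self v⟩⟩
    exact ⟨SimpleGraph.Preconnected.of_subsingleton⟩
  union_mem S hS T hT hST := by
    simp only [Finset.mem_filter, Finset.mem_univ, true_and] at hS hT ⊢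
    refine ⟨hS.1.mono Finset.subset_union_left, ?_⟩
    rw [Finset.coe_union]
    refine SimpleGraph.induce_union_connected hS.2.preconnected hT.2.preconnected ?_
    rw [← Finset.coe_inter]; exact hST

/-- The join of two graphs: their disjoint union with all edges between them added. -/
def SimpleGraph.joinGraph {V W : Type} (G : SimpleGraph V) (H : SimpleGraph W) :
    SimpleGraph (V ⊕ W) :=
  (G ⊕g H) ⊔ completeBipartiteGraph V W

/-- The permutohedron `Pe^n`: the nestohedron of the complete graph on `n + 1` nodes. -/
noncomputable def permutohedron (n : ℕ) : Polytope :=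
  (⊤ : SimpleGraph (Fin (n + 1))).buildingSet.nestohedron

/-- The nestohedron of the join of the complete graph on `k` nodes and the graph with `l` nodes
and no edges. -/
noncomputable def completeEmptyNestohedron (k l : ℕ) : Polytope :=
  ((⊤ : SimpleGraph (Fin k)).joinGraph (⊥ : SimpleGraph (Fin l))).buildingSet.nestohedron

/-- The generating function `∑_{n ≥ 0} Pe^n z^(n+1) / (n+1)!`. -/
noncomputable def permutohedronSeries : PowerSeries PolytopeRing :=
  PowerSeries.mk fun m => match m with
    | 0 => 0
    | n + 1 => (((n + 1)! : ℚ)⁻¹) • (permutohedron n).cls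

/-- The generating function `∑_{k ≥ 1} ∑_{l ≥ 0} P^{k,l} x^k / k! y^l / l!` of the family
`completeEmptyNestohedron`, where `x` is variable `0` and `y` is variable `1`. -/
noncomputable def completeEmptySeries : MvPowerSeries (Fin 2) PolytopeRing :=
  fun m => if 1 ≤ m 0 then
    (((m 0)! : ℚ)⁻¹ * ((m 1)! : ℚ)⁻¹) • (completeEmptyNestohedron (m 0) (m 1)).cls else 0

/-- The extension of `d` to power series, coefficient by coefficient. -/
noncomputable def boundarySeries (F : MvPowerSeries (Fin 2) PolytopeRing) :
    MvPowerSeries (Fin 2) PolytopeRing :=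
  fun m => boundary (MvPowerSeries.coeff m F)

/-! A face of a Minkowski sum is a sum of faces of the summands, so a face of the nestohedron of `B`
records, for each `T ∈ B`, a nonempty set `f T ⊆ T` of vertices of the simplex on `T`. The families
that occur are exactly those obeying the weak axiom of revealed preference (WARP): if `i` is chosen
from `T` and `j` from `U`, and both lie in `T ∩ U`, then `i` is chosen from `U` too. Extremeness of
a face gives the axiom. Conversely, since `B` is closed under unions of intersecting members, the
axiom makes revealed preference transitive, and `f` then consists of the minimisers of a linear form
(`Choice.exists_face`). The resulting isomorphism `faceIsoChoice` turns the rest into combinatorics.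

If the whole set `V` is in `B`, the coatoms are the `Choice.facet B S` for `S ∈ B`, `S ≠ V`
(`Choice.isCoatom_iff`). The interval below one of them splits into choices on the restriction to
`S` and choices on the contraction by `S` (`IsSplit.iicIso`), so each facet is a product of two
nestohedra (`IsSplit.cls_facet`). A vertex is a single-valued choice function. The facets through it
correspond to the elements other than the one chosen from `V`, so there are `|V| - 1` of them, which
is the dimension: this is simplicity.

For the join, the building set consists of the sets meeting the complete part and the singletons of
the other nodes. A proper `S` with `a ≥ 1` complete and `b` other nodes yields `P^{a,b}` times a
permutohedron on the remaining nodes. A singleton outside the complete part yields a point times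
`P^{k,l-1}`. Counting the `S` by `(a, b)` gives `facetSum_completeEmptyNestohedron`. Divided by `k!
l!`, its two terms are the coefficients of `P · y` and `P · Pe(x + y)`, because `1 / (c! d!)` is the
coefficient of `x^c y^d` in `(x + y)^(c+d) / (c+d)!`. -/

namespace BuildingSet

/-! ### Faces of a nestohedron as consistent choice functions -/

/-- The linear form with coefficients `w`. -/
def linForm {V : Type} [Fintype V] (w : V → ℝ) : (V → ℝ) →ₗ[ℝ] ℝ := ∑ i, w i • LinearMap.proj i

theorem linForm_apply {V : Type} [Fintype V] (w x : V → ℝ) : linForm w x = ∑ i, w i * x i := by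
  simp [linForm]

variable {V : Type} [Fintype V] [DecidableEq V]

/-- The choice functions on a building set that are consistent in the sense of the weak axiom of
revealed preference. They describe the faces of the nestohedron. -/
def Choice (B : BuildingSet V) : Type :=
  {f : Finset V → Finset V // (∀ T, T ∉ B.sets → f T = ∅) ∧ (∀ T ∈ B.sets, (f T).Nonempty) ∧
    (∀ T, f T ⊆ T) ∧ ∀ T U i j, i ∈ f T → i ∈ U → j ∈ f U → j ∈ T → i ∈ f U}

instance (B : BuildingSet V) : PartialOrder B.Choice :=
  inferInstanceAs (PartialOrder
    {f : Finset V → Finset V // (∀ T, T ∉ B.sets → f T = ∅) ∧ (∀ T ∈ B.sets, (f T).Nonempty) ∧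
      (∀ T, f T ⊆ T) ∧ ∀ T U i j, i ∈ f T → i ∈ U → j ∈ f U → j ∈ T → i ∈ f U})

/-- A consistent choice function, from its defining properties. -/
def Choice.of {B : BuildingSet V} (f : Finset V → Finset V) (h₁ : ∀ T, T ∉ B.sets → f T = ∅)
    (h₂ : ∀ T ∈ B.sets, (f T).Nonempty) (h₃ : ∀ T, f T ⊆ T)
    (h₄ : ∀ T U i j, i ∈ f T → i ∈ U → j ∈ f U → j ∈ T → i ∈ f U) : B.Choice :=
  ⟨f, h₁, h₂, h₃, h₄⟩

/-- The sum of the unit vectors selected by `s`. -/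
def selPoint (B : BuildingSet V) (s : Finset V → V) : V → ℝ :=
  ∑ T ∈ B.sets, Pi.single (s T) 1

/-- `s` selects an element of each member of `B`. -/
def IsSelection (B : BuildingSet V) (s : Finset V → V) : Prop := ∀ T ∈ B.sets, s T ∈ T

variable {B : BuildingSet V}

theorem IsSelection.update {s : Finset V → V} (hs : B.IsSelection s) {T : Finset V} {i : V}
    (hi : i ∈ T) : B.IsSelection (Function.update s T i) := by
  intro U hU
  by_cases h : U = T
  · subst h; simpa using hi
  · rw [Function.update_of_ne h]; exact hs U hU

theorem selPoint_update (s : Finset V → V) {T : Finset V} (hT : T ∈ B.sets) (i : V) :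
    B.selPoint (Function.update s T i) = B.selPoint s - Pi.single (s T) 1 + Pi.single i 1 := by
  unfold selPoint
  rw [← Finset.add_sum_erase _ _ hT, ← Finset.add_sum_erase _ _ hT, Function.update_self]
  have : ∑ x ∈ B.sets.erase T, (Pi.single (Function.update s T i x) 1 : V → ℝ) =
      ∑ x ∈ B.sets.erase T, Pi.single (s x) 1 :=
    Finset.sum_congr rfl fun x hx => by
      rw [Function.update_of_ne (Finset.ne_of_mem_erase hx)]
  rw [this]; abel

theorem mem_sum_simplexVertices [Nonempty V] {x : V → ℝ} :
    x ∈ ∑ T ∈ B.sets, simplexVertices T ↔ ∃ s, B.IsSelection s ∧ B.selPoint s = x := by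
  rw [← Finset.mem_coe, Finset.coe_sum, Set.mem_finsetSum]
  constructor
  · rintro ⟨g, hg, rfl⟩
    have : ∀ T, ∃ i, T ∈ B.sets → i ∈ T ∧ Pi.single i 1 = g T := by
      intro T
      by_cases hT : T ∈ B.sets
      · have h := hg hT
        simp only [simplexVertices, Finset.coe_map, Set.mem_image, Finset.mem_coe] at h
        obtain ⟨i, hi, h⟩ := h
        exact ⟨i, fun _ => ⟨hi, h⟩⟩
      · exact ⟨Classical.arbitrary V, fun h => absurd h hT⟩
    choose s hs using this
    exact ⟨s, fun T hT => (hs T hT).1, Finset.sum_congr rfl fun T hT => (hs T hT).2⟩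
  · rintro ⟨s, hs, rfl⟩
    refine ⟨fun T => Pi.single (s T) 1, fun {T} hT => ?_, rfl⟩
    simp only [simplexVertices, Finset.coe_map, Set.mem_image, Finset.mem_coe]
    exact ⟨s T, hs T hT, rfl⟩

theorem carrier_eq : B.nestohedron.carrier =
    convexHull ℝ ((∑ T ∈ B.sets, simplexVertices T : Finset (V → ℝ)) : Set (V → ℝ)) := by
  rw [Finset.coe_sum, convexHull_sum]; rfl

theorem selPoint_mem [Nonempty V] {s : Finset V → V} (hs : B.IsSelection s) :
    B.selPoint s ∈ B.nestohedron.carrier := by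
  rw [carrier_eq]
  exact subset_convexHull ℝ _ (mem_sum_simplexVertices.2 ⟨s, hs, rfl⟩)

/-- A face is the hull of the generating points it contains, and these are the points of selections.
-/
theorem face_le_iff [Nonempty V] {F G : B.nestohedron.Face} :
    F ≤ G ↔ ∀ s, B.IsSelection s → B.selPoint s ∈ F.1 → B.selPoint s ∈ G.1 := by
  constructor
  · intro h s _ hF
    exact h hF
  · intro h
    change F.1 ⊆ G.1
    rw [Polytope.Face.eq_convexHull _ _ carrier_eq F]
    refine convexHull_min ?_ G.2.2.1
    rintro x ⟨hx, hF⟩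
    obtain ⟨s, hs, rfl⟩ := mem_sum_simplexVertices.1 hx
    exact h s hs hF

theorem exists_selPoint_mem [Nonempty V] (F : B.nestohedron.Face) :
    ∃ s, B.IsSelection s ∧ B.selPoint s ∈ F.1 := by
  have h := F.2.1
  rw [Polytope.Face.eq_convexHull _ _ carrier_eq F, convexHull_nonempty_iff] at h
  obtain ⟨x, hx, hF⟩ := h
  obtain ⟨s, hs, rfl⟩ := mem_sum_simplexVertices.1 hx
  exact ⟨s, hs, hF⟩

/-- Exchanging the `T`-components of `s` and `s'` leaves the midpoint of the two points unchanged.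
That midpoint is in `F`, so extremeness puts the new endpoints in `F`. -/
theorem update_mem_face [Nonempty V] (F : B.nestohedron.Face) {s s' : Finset V → V}
    (hs : B.IsSelection s) (hs' : B.IsSelection s') (h : B.selPoint s ∈ F.1)
    (h' : B.selPoint s' ∈ F.1) {T : Finset V} (hT : T ∈ B.sets) :
    B.selPoint (Function.update s T (s' T)) ∈ F.1 := by
  have hm : (2⁻¹ : ℝ) • B.selPoint s + (2⁻¹ : ℝ) • B.selPoint s' ∈ F.1 :=
    F.2.2.1 h h' (by norm_num) (by norm_num) (by norm_num)
  have key : (2⁻¹ : ℝ) • B.selPoint (Function.update s T (s' T)) +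
      (2⁻¹ : ℝ) • B.selPoint (Function.update s' T (s T)) =
      (2⁻¹ : ℝ) • B.selPoint s + (2⁻¹ : ℝ) • B.selPoint s' := by
    rw [selPoint_update s hT, selPoint_update s' hT]
    module
  exact F.2.2.2.left_mem_of_mem_openSegment (selPoint_mem (hs.update (hs' T hT)))
    (selPoint_mem (hs'.update (hs T hT))) hm
    ⟨2⁻¹, 2⁻¹, by norm_num, by norm_num, by norm_num, key⟩

/-- The elements of `T` that are selected by the points of the face `F`. -/
noncomputable def faceChoice (F : B.nestohedron.Face) (T : Finset V) : Finset V := by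
  classical
  exact if T ∈ B.sets then
    T.filter fun i => ∃ s, B.IsSelection s ∧ s T = i ∧ B.selPoint s ∈ F.1 else ∅

theorem mem_faceChoice {F : B.nestohedron.Face} {T : Finset V} {i : V} :
    i ∈ faceChoice F T ↔
      T ∈ B.sets ∧ ∃ s, B.IsSelection s ∧ s T = i ∧ B.selPoint s ∈ F.1 := by
  unfold faceChoice
  split_ifs with h
  · simp only [Finset.mem_filter, h, true_and, and_iff_right_iff_imp]
    rintro ⟨s, hs, rfl, -⟩
    exact hs T h
  · simp [h]

/-- The summands can be varied independently: starting from any selection in `F`, its components are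
replaced by those of `s` one at a time with `update_mem_face`. -/
theorem selPoint_mem_iff_faceChoice [Nonempty V] {F : B.nestohedron.Face} {s : Finset V → V}
    (hs : B.IsSelection s) :
    B.selPoint s ∈ F.1 ↔ ∀ T ∈ B.sets, s T ∈ faceChoice F T := by
  constructor
  · intro h T hT
    exact mem_faceChoice.2 ⟨hT, s, hs, rfl, h⟩
  · intro h
    have key : ∀ A : Finset (Finset V), A ⊆ B.sets →
        ∃ s', B.IsSelection s' ∧ B.selPoint s' ∈ F.1 ∧ ∀ T ∈ A, s' T = s T := by
      intro A
      induction A using Finset.induction_on with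
      | empty =>
        intro _
        obtain ⟨s', h1, h2⟩ := exists_selPoint_mem F
        exact ⟨s', h1, h2, by simp⟩
      | insert T A hTA ih =>
        intro hA
        obtain ⟨s', h1, h2, h3⟩ := ih ((Finset.subset_insert _ _).trans hA)
        have hT := hA (Finset.mem_insert_self _ _)
        obtain ⟨-, t, ht, htT, htF⟩ := mem_faceChoice.1 (h T hT)
        refine ⟨_, h1.update (ht T hT), update_mem_face F h1 ht h2 htF hT, ?_⟩
        intro U hU
        by_cases hUT : U = T
        · subst hUT; rw [Function.update_self, htT]
        · rw [Function.update_of_ne hUT]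
          exact h3 U ((Finset.mem_insert.1 hU).resolve_left hUT)
    obtain ⟨s', h1, h2, h3⟩ := key B.sets subset_rfl
    have : B.selPoint s = B.selPoint s' :=
      Finset.sum_congr rfl fun T hT => by rw [h3 T hT]
    rw [this]; exact h2

/-- The consistent choice function of a face. -/
noncomputable def toChoice [Nonempty V] (F : B.nestohedron.Face) : B.Choice := by
  refine ⟨faceChoice F, fun T hT => by simp [faceChoice, hT], fun T hT => ?_, fun T i hi => ?_, ?_⟩
  · obtain ⟨s, hs, h⟩ := exists_selPoint_mem F
    exact ⟨s T, mem_faceChoice.2 ⟨hT, s, hs, rfl, h⟩⟩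
  · obtain ⟨hT, s, hs, rfl, -⟩ := mem_faceChoice.1 hi
    exact hs T hT
  · intro T U i j hi hiU hj hjT
    obtain ⟨hT, s, hs, rfl, hsF⟩ := mem_faceChoice.1 hi
    obtain ⟨hU, t, ht, rfl, htF⟩ := mem_faceChoice.1 hj
    by_cases hTU : T = U
    · subst hTU; exact hi
    -- First make `U` select `j` while `T` still selects `i`; then let `T` and `U` trade these
    -- elements. The trade does not move the point, so `i` is selected from `U` by a point of `F`.
    have h1 := hs.update (ht U hU)
    have h2 := update_mem_face F hs ht hsF htF hU
    have h3 := (h1.update hiU).update hjT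
    refine mem_faceChoice.2 ⟨hU, _, h3, ?_, ?_⟩
    · rw [Function.update_of_ne (Ne.symm hTU), Function.update_self]
    · rw [selPoint_update _ hT, selPoint_update _ hU, Function.update_of_ne hTU,
        Function.update_of_ne hTU, Function.update_self]
      convert h2 using 1
      abel

namespace Choice

theorem warp (f : B.Choice) {T U : Finset V} {i j : V} (hi : i ∈ f.1 T) (hiU : i ∈ U)
    (hj : j ∈ f.1 U) (hjT : j ∈ T) : i ∈ f.1 U := f.2.2.2.2 T U i j hi hiU hj hjT

theorem subset (f : B.Choice) (T : Finset V) : f.1 T ⊆ T := f.2.2.2.1 T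

theorem nonempty (f : B.Choice) {T : Finset V} (hT : T ∈ B.sets) : (f.1 T).Nonempty :=
  f.2.2.1 T hT

theorem mem_sets (f : B.Choice) {T : Finset V} {i : V} (hi : i ∈ f.1 T) : T ∈ B.sets := by
  by_contra h
  rw [f.2.1 T h] at hi
  simp at hi

/-- `i` is chosen from some set containing `j`. -/
def Pref (f : B.Choice) (i j : V) : Prop := ∃ T, i ∈ f.1 T ∧ j ∈ T

/-- Something is chosen from `T ∪ U`. If it lies in `T`, WARP adds `i`; if it lies in `U`, WARP adds
first `j`, then `i`. This is where closure of `B` under intersecting unions is needed, and it yields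
transitivity of `Pref`. -/
theorem chosen_union (f : B.Choice) {T U : Finset V} {i j : V} (hi : i ∈ f.1 T) (hjT : j ∈ T)
    (hj : j ∈ f.1 U) : i ∈ f.1 (T ∪ U) := by
  have hTU : T ∪ U ∈ B.sets := B.union_mem T (f.mem_sets hi) U (f.mem_sets hj)
    ⟨j, Finset.mem_inter.2 ⟨hjT, f.subset U hj⟩⟩
  have hiT := Finset.mem_union_left U (f.subset T hi)
  obtain ⟨c, hc⟩ := f.nonempty hTU
  rcases Finset.mem_union.1 (f.subset _ hc) with h | h
  · exact f.warp hi hiT hc h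
  · have hj' : j ∈ f.1 (T ∪ U) := f.warp hj (Finset.mem_union_left U hjT) hc h
    exact f.warp hi hiT hj' hjT

theorem Pref.trans {f : B.Choice} {i j k : V} (h : f.Pref i j) (h' : f.Pref j k) :
    f.Pref i k := by
  obtain ⟨T, hi, hj⟩ := h
  obtain ⟨U, hj', hk⟩ := h'
  exact ⟨T ∪ U, f.chosen_union hi hj hj', Finset.mem_union_right T hk⟩

theorem pref_refl (f : B.Choice) (i : V) : f.Pref i i := by
  obtain ⟨j, hj⟩ := f.nonempty (B.singleton_mem i)
  have := Finset.mem_singleton.1 (f.subset _ hj)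
  subst this
  exact ⟨_, hj, Finset.mem_singleton_self _⟩

theorem mem_of_pref (f : B.Choice) {T : Finset V} {i j : V} (hi : i ∈ f.1 T) (hj : j ∈ T)
    (h : f.Pref j i) : j ∈ f.1 T := by
  obtain ⟨U, hjU, hiU⟩ := h
  exact f.warp hjU hj hi hiU

open Classical in
/-- A weight whose minima on the members of the building set are the chosen elements. -/
noncomputable def weight (f : B.Choice) (i : V) : ℝ :=
  ((Finset.univ.filter fun j => f.Pref j i).card : ℝ)

theorem weight_le (f : B.Choice) {T : Finset V} {i j : V} (hi : i ∈ f.1 T) (hj : j ∈ T) :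
    f.weight i ≤ f.weight j := by
  classical
  unfold weight
  refine Nat.cast_le.2 (Finset.card_le_card fun k hk => ?_)
  simp only [Finset.mem_filter, Finset.mem_univ, true_and] at hk ⊢
  exact hk.trans ⟨T, hi, hj⟩

/-- By transitivity everything preferred to `i` is preferred to `j`; strictness comes from `j`
itself, which is preferred to `j` but not to `i`. -/
theorem weight_lt (f : B.Choice) {T : Finset V} {i j : V} (hi : i ∈ f.1 T) (hj : j ∈ T)
    (hj' : j ∉ f.1 T) : f.weight i < f.weight j := by
  classical
  unfold weight
  refine Nat.cast_lt.2 (Finset.card_lt_card (Finset.ssubset_iff_subset_ne.2 ⟨fun k hk => ?_, ?_⟩))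
  · simp only [Finset.mem_filter, Finset.mem_univ, true_and] at hk ⊢
    exact hk.trans ⟨T, hi, hj⟩
  · intro h
    have : j ∈ Finset.univ.filter fun k => f.Pref k i := by
      rw [h]; simpa using f.pref_refl j
    exact hj' (f.mem_of_pref hi hj (by simpa using this))

end Choice

theorem sum_weight_selPoint (w : V → ℝ) (s : Finset V → V) :
    ∑ i, w i * B.selPoint s i = ∑ T ∈ B.sets, w (s T) := by
  simp only [selPoint, Finset.sum_apply, Finset.mul_sum]
  rw [Finset.sum_comm]
  refine Finset.sum_congr rfl fun T _ => ?_
  simp [Pi.single_apply]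

theorem Choice.exists_selection [Nonempty V] (f : B.Choice) :
    ∃ s : Finset V → V, ∀ T ∈ B.sets, s T ∈ f.1 T := by
  have : ∀ T, ∃ i, T ∈ B.sets → i ∈ f.1 T := fun T => by
    by_cases hT : T ∈ B.sets
    · obtain ⟨i, hi⟩ := f.nonempty hT
      exact ⟨i, fun _ => hi⟩
    · exact ⟨Classical.arbitrary V, fun h => absurd h hT⟩
  choose s hs using this
  exact ⟨s, hs⟩

theorem Choice.sum_weight_le [Nonempty V] (f : B.Choice) {s t : Finset V → V}
    (hs : ∀ T ∈ B.sets, s T ∈ f.1 T) (ht : B.IsSelection t) :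
    ∑ T ∈ B.sets, f.weight (s T) ≤ ∑ T ∈ B.sets, f.weight (t T) :=
  Finset.sum_le_sum fun T hT => f.weight_le (hs T hT) (ht T hT)

/-- The face is the one where the linear form with coefficients `f.weight` attains its minimum over
the nestohedron. -/
theorem Choice.exists_face [Nonempty V] (f : B.Choice) :
    ∃ F : B.nestohedron.Face, ∀ t, B.IsSelection t →
      (B.selPoint t ∈ F.1 ↔ ∀ T ∈ B.sets, t T ∈ f.1 T) := by
  obtain ⟨s, hs⟩ := f.exists_selection
  have hsel : B.IsSelection s := fun T hT => f.subset T (hs T hT)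
  set L := linForm f.weight with hL
  set m := ∑ T ∈ B.sets, f.weight (s T) with hm
  have hLp : ∀ t, L (B.selPoint t) = ∑ T ∈ B.sets, f.weight (t T) := fun t => by
    rw [hL, linForm_apply, sum_weight_selPoint]
  have hmin : ∀ x ∈ B.nestohedron.carrier, m ≤ L x := by
    have : B.nestohedron.carrier ⊆ {x | m ≤ L x} := by
      rw [carrier_eq]
      refine convexHull_min ?_ (convex_halfSpace_ge L.isLinear m)
      intro x hx
      obtain ⟨t, ht, rfl⟩ := mem_sum_simplexVertices.1 hx
      change m ≤ L _
      rw [hLp]; exact f.sum_weight_le hs ht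
    exact this
  refine ⟨⟨{x | x ∈ B.nestohedron.carrier ∧ L x = m}, ⟨_, selPoint_mem hsel, hLp s⟩, ?_, ?_⟩, ?_⟩
  · exact B.nestohedron.convex.inter (convex_hyperplane L.isLinear m)
  · refine ⟨fun x hx => hx.1, ?_⟩
    intro (x : V → ℝ) hx (y : V → ℝ) hy
    rintro _ ⟨-, hzm⟩ ⟨a, b, ha, hb, hab, rfl⟩
    replace hzm : L (a • x + b • y) = m := hzm
    refine ⟨hx, ?_⟩
    have hx' := hmin x hx
    have hy' := hmin y hy
    rw [map_add, map_smul, map_smul, smul_eq_mul, smul_eq_mul] at hzm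
    have hb' : b * m ≤ b * L y := mul_le_mul_of_nonneg_left hy' hb.le
    have : a * L x ≤ a * m := by
      have : a * m + b * m = m := by rw [← add_mul, hab, one_mul]
      linarith
    exact le_antisymm (le_of_mul_le_mul_left this ha) hx'
  · intro t ht
    refine (and_iff_right (selPoint_mem ht)).trans ?_
    -- The minimal sum is attained only if every summand is minimal, so the condition decouples over
    -- the members of `B`.
    rw [hLp, eq_comm, hm,
      Finset.sum_eq_sum_iff_of_le fun T hT => f.weight_le (hs T hT) (ht T hT)]
    refine forall₂_congr fun T hT => ⟨fun h => ?_, fun h => ?_⟩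
    · by_contra h'
      exact (f.weight_lt (hs T hT) (ht T hT) h').ne h
    · exact le_antisymm (f.weight_le (hs T hT) (ht T hT)) (f.weight_le h (f.subset T (hs T hT)))

theorem toChoice_le_iff [Nonempty V] {F G : B.nestohedron.Face} :
    toChoice F ≤ toChoice G ↔ F ≤ G := by
  rw [face_le_iff]
  constructor
  · intro h s hs hF
    rw [selPoint_mem_iff_faceChoice hs] at hF ⊢
    exact fun T hT => h T (hF T hT)
  · intro h T i hi
    obtain ⟨hT, s, hs, rfl, hF⟩ := mem_faceChoice.1 hi
    exact mem_faceChoice.2 ⟨hT, s, hs, rfl, h s hs hF⟩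

theorem toChoice_surjective [Nonempty V] :
    Function.Surjective (toChoice : B.nestohedron.Face → B.Choice) := by
  intro f
  obtain ⟨F, hF⟩ := f.exists_face
  refine ⟨F, Subtype.ext (funext fun T => Finset.ext fun i => ?_)⟩
  change i ∈ faceChoice F T ↔ _
  rw [mem_faceChoice]
  constructor
  · rintro ⟨hT, s, hs, rfl, h⟩
    exact (hF s hs).1 h T hT
  · intro hi
    obtain ⟨s, hs⟩ := f.exists_selection
    have hs' : B.IsSelection s := fun T hT => f.subset T (hs T hT)
    -- To realise `i` at `T`, take any selection from `f` and force its value at `T` to be `i`.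
    have h1 := hs'.update (f.subset T hi)
    refine ⟨f.mem_sets hi, _, h1, Function.update_self .., (hF _ h1).2 fun U hU => ?_⟩
    by_cases h : U = T
    · subst h; simpa using hi
    · rw [Function.update_of_ne h]; exact hs U hU

/-- The faces of a nestohedron correspond to the consistent choice functions on the building
set. -/
noncomputable def faceIsoChoice [Nonempty V] (B : BuildingSet V) :
    B.nestohedron.Face ≃o B.Choice where
  toEquiv := Equiv.ofBijective toChoice
    ⟨fun _ _ h => le_antisymm (toChoice_le_iff.1 h.le) (toChoice_le_iff.1 h.ge),
      toChoice_surjective⟩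
  map_rel_iff' := toChoice_le_iff

end BuildingSet

/-! ### Facets of the nestohedron of a connected building set -/

namespace BuildingSet

variable {V : Type} [Fintype V] [DecidableEq V] {B : BuildingSet V}

instance (B : BuildingSet V) : OrderTop B.Choice where
  top := Choice.of (fun T => if T ∈ B.sets then T else ∅) (fun T hT => if_neg hT)
    (fun T hT => by rw [if_pos hT]; exact B.nonempty_of_mem T hT)
    (fun T => by split_ifs <;> simp) (by
      intro T U i j _ hiU hj _
      split_ifs at hj ⊢ with h
      · exact hiU
      · simp at hj)
  le_top f := fun T i hi => by
    change i ∈ if T ∈ B.sets then T else ∅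
    rw [if_pos (f.mem_sets hi)]; exact f.subset T hi

namespace Choice

theorem mem_top {T : Finset V} {i : V} : i ∈ (⊤ : B.Choice).1 T ↔ T ∈ B.sets ∧ i ∈ T := by
  change (i ∈ if T ∈ B.sets then T else ∅) ↔ _
  split_ifs with h <;> simp [h]

/-- The choice function of the face on which the sum of the coordinates in `S` is minimal. -/
def facet (B : BuildingSet V) (S : Finset V) : B.Choice := by
  refine Choice.of (fun T => if T ∈ B.sets then (if T ⊆ S then T else T \ S) else ∅)
    (fun T hT => if_neg hT) (fun T hT => ?_) (fun T => ?_) ?_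
  · rw [if_pos hT]
    split_ifs with h
    · exact B.nonempty_of_mem T hT
    · exact Finset.sdiff_nonempty.2 h
  · split_ifs
    · exact subset_rfl
    · exact Finset.sdiff_subset
    · simp
  · intro T U i j hi hiU hj hjT
    by_cases hT : T ∈ B.sets <;> by_cases hU : U ∈ B.sets <;> simp only [hT, hU, if_true,
      if_false, Finset.notMem_empty] at hi hj ⊢
    by_cases h2 : U ⊆ S
    · rwa [if_pos h2]
    · rw [if_neg h2, Finset.mem_sdiff] at hj ⊢
      have h1 : ¬ T ⊆ S := fun h => hj.2 (h hjT)
      rw [if_neg h1] at hi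
      exact ⟨hiU, (Finset.mem_sdiff.1 hi).2⟩

theorem mem_facet {S T : Finset V} {i : V} :
    i ∈ (facet B S).1 T ↔ T ∈ B.sets ∧ i ∈ T ∧ (i ∈ S → T ⊆ S) := by
  change (i ∈ if T ∈ B.sets then (if T ⊆ S then T else T \ S) else ∅) ↔ _
  by_cases h : T ∈ B.sets <;> by_cases h' : T ⊆ S <;> simp [h, h']

theorem le_facet_iff {f : B.Choice} {S : Finset V} :
    f ≤ facet B S ↔ ∀ T i, i ∈ f.1 T → i ∈ S → T ⊆ S := by
  constructor
  · intro h T i hi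
    exact (mem_facet.1 (h T hi)).2.2
  · intro h T i hi
    exact mem_facet.2 ⟨f.mem_sets hi, f.subset T hi, h T i hi⟩

/-- An element of `S'` outside `S` would be chosen from the whole set, forcing `S'` to be
everything. So `S' ⊆ S`, and then any element of `S'` is chosen from `S`, forcing `S ⊆ S'`. -/
theorem eq_of_facet_le {S S' : Finset V} (hV : Finset.univ ∈ B.sets) (hS : S ∈ B.sets)
    (hS' : S' ∈ B.sets) (h'' : S' ≠ Finset.univ)
    (h : facet B S ≤ facet B S') : S = S' := by
  rw [le_facet_iff] at h
  have h1 : S' ⊆ S := by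
    intro i hi
    by_contra hiS
    exact h'' (Finset.univ_subset_iff.1 (h Finset.univ i
      (mem_facet.2 ⟨hV, Finset.mem_univ i, fun h => absurd h hiS⟩) hi))
  refine subset_antisymm ?_ h1
  obtain ⟨i, hi⟩ := B.nonempty_of_mem S' hS'
  exact h S i (mem_facet.2 ⟨hS, h1 hi, fun _ => subset_rfl⟩) hi

theorem facet_ne_top {S : Finset V} (hV : Finset.univ ∈ B.sets) (hS : S ∈ B.sets)
    (h : S ≠ Finset.univ) : facet B S ≠ ⊤ := by
  intro ht
  obtain ⟨i, hi⟩ := B.nonempty_of_mem S hS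
  have : i ∈ (facet B S).1 Finset.univ := by rw [ht, mem_top]; exact ⟨hV, Finset.mem_univ i⟩
  exact h (Finset.univ_subset_iff.1 ((mem_facet.1 this).2.2 hi))

open Classical in
/-- The largest set from which `a` is chosen. -/
noncomputable def prefSet (f : B.Choice) (a : V) : Finset V :=
  Finset.univ.filter fun j => f.Pref a j

theorem mem_prefSet {f : B.Choice} {a j : V} : j ∈ f.prefSet a ↔ f.Pref a j := by
  simp [prefSet]

/-- The sets from which `a` is chosen all contain `a`, so by `chosen_union` they are closed under
finite unions. -/
theorem mem_choice_prefSet (f : B.Choice) (a : V) : a ∈ f.1 (f.prefSet a) := by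
  have key : ∀ A ⊆ f.prefSet a, ∃ U, A ⊆ U ∧ a ∈ f.1 U := by
    intro A
    induction A using Finset.induction_on with
    | empty =>
      intro _
      obtain ⟨U, hU, -⟩ := f.pref_refl a
      exact ⟨U, Finset.empty_subset _, hU⟩
    | insert j A _ ih =>
      intro hA
      obtain ⟨U, hAU, hU⟩ := ih ((Finset.subset_insert _ _).trans hA)
      obtain ⟨T, hT, hjT⟩ := mem_prefSet.1 (hA (Finset.mem_insert_self _ _))
      refine ⟨T ∪ U, ?_, f.chosen_union hT (f.subset T hT) hU⟩
      exact Finset.insert_subset (Finset.mem_union_left _ hjT)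
        (hAU.trans Finset.subset_union_right)
  obtain ⟨U, h1, h2⟩ := key _ subset_rfl
  have : f.prefSet a = U := subset_antisymm h1 fun j hj => mem_prefSet.2 ⟨U, h2, hj⟩
  rw [this]; exact h2

theorem prefSet_mem (f : B.Choice) (a : V) : f.prefSet a ∈ B.sets :=
  f.mem_sets (f.mem_choice_prefSet a)

theorem le_facet_prefSet (f : B.Choice) (a : V) : f ≤ facet B (f.prefSet a) :=
  le_facet_iff.2 fun T _ hi hiS _ hj =>
    mem_prefSet.2 ((mem_prefSet.1 hiS).trans ⟨T, hi, hj⟩)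

/-- Some `a` in some `T ∈ B` is not chosen from it. The witness is `f.prefSet a`: were it
everything, `a` would be preferred to an element chosen from `T`, hence chosen itself. -/
theorem exists_le_facet {f : B.Choice} (hf : f ≠ ⊤) :
    ∃ S ∈ B.sets, S ≠ Finset.univ ∧ f ≤ facet B S := by
  have : ∃ T a, a ∈ (⊤ : B.Choice).1 T ∧ a ∉ f.1 T := by
    by_contra! h
    exact hf (top_le_iff.1 fun T a ha => h T a ha)
  obtain ⟨T, a, ha, haf⟩ := this
  obtain ⟨hT, ha⟩ := mem_top.1 ha
  refine ⟨f.prefSet a, f.prefSet_mem a, fun h => ?_, f.le_facet_prefSet a⟩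
  obtain ⟨c, hc⟩ := f.nonempty hT
  refine haf (f.mem_of_pref hc ha (mem_prefSet.1 ?_))
  rw [h]; exact Finset.mem_univ c

theorem isCoatom_iff (hV : Finset.univ ∈ B.sets) {f : B.Choice} :
    IsCoatom f ↔ ∃ S ∈ B.sets, S ≠ Finset.univ ∧ f = facet B S := by
  constructor
  · intro h
    obtain ⟨S, hS, hS', hle⟩ := exists_le_facet h.1
    exact ⟨S, hS, hS', (h.le_iff.1 hle).resolve_left (facet_ne_top hV hS hS') |>.symm⟩
  · rintro ⟨S, hS, hS', rfl⟩
    refine ⟨facet_ne_top hV hS hS', fun g hg => ?_⟩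
    by_contra hne
    obtain ⟨S', h1, h2, hle⟩ := exists_le_facet hne
    have := eq_of_facet_le hV hS h1 h2 (hg.le.trans hle)
    subst this
    exact hg.not_ge hle

theorem eq_of_subsingleton [Subsingleton V] (f g : B.Choice) : f = g := by
  have : ∀ f g : B.Choice, f ≤ g := by
    intro f g T i hi
    obtain ⟨j, hj⟩ := g.nonempty (f.mem_sets hi)
    rwa [Subsingleton.elim i j]
  exact le_antisymm (this f g) (this g f)

end Choice

/-- The facets of the nestohedron of a connected building set `B` correspond to the members of `B`
other than the whole set. -/
noncomputable def facetEquiv [Nonempty V] (hV : Finset.univ ∈ B.sets) :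
    {S // S ∈ B.sets ∧ S ≠ Finset.univ} ≃ B.nestohedron.Facet :=
  Equiv.ofBijective (fun S => ⟨B.faceIsoChoice.symm (Choice.facet B S.1),
      (B.faceIsoChoice.symm.isCoatom_iff _).2
        ((Choice.isCoatom_iff hV).2 ⟨S.1, S.2.1, S.2.2, rfl⟩)⟩) (by
    constructor
    · intro S S' h
      have h' : Choice.facet B S.1 = Choice.facet B S'.1 :=
        B.faceIsoChoice.symm.injective (Subtype.ext_iff.1 h)
      exact Subtype.ext (Choice.eq_of_facet_le hV S.2.1 S'.2.1 S'.2.2 h'.le)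
    · rintro ⟨F, hF⟩
      obtain ⟨S, h1, h2, h3⟩ :=
        (Choice.isCoatom_iff hV).1 ((B.faceIsoChoice.isCoatom_iff F).2 hF)
      refine ⟨⟨S, h1, h2⟩, Subtype.ext ?_⟩
      change B.faceIsoChoice.symm (Choice.facet B S) = F
      rw [← h3, OrderIso.symm_apply_apply])

theorem facetSum_eq [Nonempty V] (hV : Finset.univ ∈ B.sets) :
    B.nestohedron.facetSum = ∑ S ∈ B.sets.erase Finset.univ,
      (B.faceIsoChoice.symm (Choice.facet B S)).toPolytope.cls := by
  have h : B.nestohedron.facetSum = ∑ᶠ S : {S // S ∈ B.sets ∧ S ≠ Finset.univ},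
      (B.faceIsoChoice.symm (Choice.facet B S.1)).toPolytope.cls :=
    (finsum_eq_of_bijective (facetEquiv hV) (facetEquiv hV).bijective fun _ => rfl).symm
  rw [h, finsum_eq_sum_of_fintype]
  exact (Finset.sum_subtype _ (fun S => by rw [Finset.mem_erase, and_comm])
    fun S => (B.faceIsoChoice.symm (Choice.facet B S)).toPolytope.cls).symm

/-! ### Facets as products: restriction and contraction -/

section Product

variable {V₁ V₂ : Type} [Fintype V₁] [DecidableEq V₁] [Fintype V₂] [DecidableEq V₂]
  {B₁ : BuildingSet V₁} {B₂ : BuildingSet V₂} {S : Finset V} {e₁ : V₁ ↪ V} {e₂ : V₂ ↪ V}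

/-- `B₁` is the restriction of `B` to `S`, and `B₂` is the contraction of `B` by `S`, up to
relabelling. -/
structure IsSplit (B : BuildingSet V) (S : Finset V) (B₁ : BuildingSet V₁) (B₂ : BuildingSet V₂)
    (e₁ : V₁ ↪ V) (e₂ : V₂ ↪ V) : Prop where
  mem_iff : ∀ i, i ∈ S ↔ ∃ j, e₁ j = i
  notMem_iff : ∀ i, i ∉ S ↔ ∃ j, e₂ j = i
  mem_left : ∀ T, T ∈ B₁.sets ↔ T.map e₁ ∈ B.sets
  mem_right : ∀ U, U ∈ B₂.sets ↔ ∃ T ∈ B.sets, ¬ T ⊆ S ∧ T \ S = U.map e₂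

theorem IsSplit.map_preimage_left (h : IsSplit B S B₁ B₂ e₁ e₂) {T : Finset V} (hT : T ⊆ S) :
    (T.preimage e₁ e₁.injective.injOn).map e₁ = T := by
  ext i
  simp only [Finset.mem_map, Finset.mem_preimage]
  constructor
  · rintro ⟨j, hj, rfl⟩; exact hj
  · intro hi
    obtain ⟨j, rfl⟩ := (h.mem_iff i).1 (hT hi)
    exact ⟨j, hi, rfl⟩

theorem IsSplit.map_preimage_right (h : IsSplit B S B₁ B₂ e₁ e₂) (T : Finset V) :
    ((T \ S).preimage e₂ e₂.injective.injOn).map e₂ = T \ S := by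
  ext i
  simp only [Finset.mem_map, Finset.mem_preimage]
  constructor
  · rintro ⟨j, hj, rfl⟩; exact hj
  · intro hi
    obtain ⟨j, rfl⟩ := (h.notMem_iff i).1 (Finset.mem_sdiff.1 hi).2
    exact ⟨j, hi, rfl⟩

namespace Choice

theorem notMem_of_le_facet {f : B.Choice} (hf : f ≤ facet B S) {T : Finset V}
    (hT : ¬ T ⊆ S) {i : V} (hi : i ∈ f.1 T) : i ∉ S :=
  fun h => hT (le_facet_iff.1 hf T i hi h)

/-- The restriction of a choice function to the subsets of `S`. -/
noncomputable def restrict (h : IsSplit B S B₁ B₂ e₁ e₂) (f : B.Choice) : B₁.Choice := by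
  refine Choice.of (fun T => (f.1 (T.map e₁)).preimage e₁ e₁.injective.injOn) (fun T hT => ?_)
    (fun T hT => ?_) (fun T j hj => ?_) (fun T U i j hi hiU hj hjT => ?_)
  · rw [f.2.1 _ fun h' => hT ((h.mem_left T).2 h')]; simp
  · obtain ⟨i, hi⟩ := f.nonempty ((h.mem_left T).1 hT)
    obtain ⟨j, -, rfl⟩ := Finset.mem_map.1 (f.subset _ hi)
    exact ⟨j, Finset.mem_preimage.2 hi⟩
  · exact (Finset.mem_map' e₁).1 (f.subset _ (Finset.mem_preimage.1 hj))
  · rw [Finset.mem_preimage] at hi hj ⊢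
    exact f.warp hi ((Finset.mem_map' e₁).2 hiU) hj ((Finset.mem_map' e₁).2 hjT)

theorem mem_restrict {h : IsSplit B S B₁ B₂ e₁ e₂} {f : B.Choice} {T : Finset V₁} {j : V₁} :
    j ∈ (restrict h f).1 T ↔ e₁ j ∈ f.1 (T.map e₁) := by
  unfold restrict
  exact Finset.mem_preimage (hf := e₁.injective.injOn)

open Classical in
/-- The choice function on the contraction by `S` that is induced by a choice function which
avoids `S` whenever possible. -/
noncomputable def contract (h : IsSplit B S B₁ B₂ e₁ e₂) (f : B.Choice) (hf : f ≤ facet B S) :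
    B₂.Choice := by
  refine Choice.of (fun U => Finset.univ.filter fun j => ∃ T, T \ S = U.map e₂ ∧ e₂ j ∈ f.1 T)
    (fun U hU => ?_) (fun U hU => ?_) (fun U j hj => ?_) (fun U U' i j hi hiU hj hjU => ?_)
  · refine Finset.filter_eq_empty_iff.2 fun j _ => ?_
    rintro ⟨T, hT, hj⟩
    exact hU ((h.mem_right U).2 ⟨T, f.mem_sets hj,
      fun hTS => (h.notMem_iff _).2 ⟨j, rfl⟩ (hTS (f.subset T hj)), hT⟩)
  · obtain ⟨T, hT, hTS, hTU⟩ := (h.mem_right U).1 hU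
    obtain ⟨i, hi⟩ := f.nonempty hT
    obtain ⟨j, rfl⟩ := (h.notMem_iff i).1 (notMem_of_le_facet hf hTS hi)
    exact ⟨j, by simpa using ⟨T, hTU, hi⟩⟩
  · obtain ⟨T, hT, hj⟩ := (Finset.mem_filter.1 hj).2
    refine (Finset.mem_map' e₂).1 ?_
    rw [← hT]
    exact Finset.mem_sdiff.2 ⟨f.subset T hj, (h.notMem_iff _).2 ⟨j, rfl⟩⟩
  · obtain ⟨T, hT, hi⟩ := (Finset.mem_filter.1 hi).2
    obtain ⟨T', hT', hj⟩ := (Finset.mem_filter.1 hj).2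
    refine Finset.mem_filter.2 ⟨Finset.mem_univ _, T', hT', f.warp hi ?_ hj ?_⟩
    · have := (Finset.mem_map' e₂).2 hiU
      rw [← hT'] at this
      exact (Finset.mem_sdiff.1 this).1
    · have := (Finset.mem_map' e₂).2 hjU
      rw [← hT] at this
      exact (Finset.mem_sdiff.1 this).1

theorem mem_contract {h : IsSplit B S B₁ B₂ e₁ e₂} {f : B.Choice} {hf : f ≤ facet B S}
    {U : Finset V₂} {j : V₂} :
    j ∈ (contract h f hf).1 U ↔ ∃ T, T \ S = U.map e₂ ∧ e₂ j ∈ f.1 T := by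
  simp [contract, Choice.of]

theorem restrict_mono (h : IsSplit B S B₁ B₂ e₁ e₂) {f g : B.Choice} (hfg : f ≤ g) :
    restrict h f ≤ restrict h g :=
  fun _ j hj => (mem_restrict (j := j)).2 (hfg _ (mem_restrict.1 hj))

theorem contract_mono (h : IsSplit B S B₁ B₂ e₁ e₂) {f g : B.Choice} {hf : f ≤ facet B S}
    {hg : g ≤ facet B S} (hfg : f ≤ g) : contract h f hf ≤ contract h g hg := by
  intro U j hj
  obtain ⟨T, hT, hj⟩ := mem_contract.1 hj
  exact mem_contract.2 ⟨T, hT, hfg T hj⟩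

/-- Below `facet B S`, choices from sets inside `S` are seen by the restriction, and choices from
all other sets lie outside `S` and are seen by the contraction. -/
theorem le_of_restrict_contract {h : IsSplit B S B₁ B₂ e₁ e₂} {f g : B.Choice}
    {hf : f ≤ facet B S} {hg : g ≤ facet B S} (h₁ : restrict h f ≤ restrict h g)
    (h₂ : contract h f hf ≤ contract h g hg) : f ≤ g := by
  intro T i hi
  by_cases hT : T ⊆ S
  · obtain ⟨j, rfl⟩ := (h.mem_iff i).1 (hT (f.subset T hi))
    have := h₁ (T.preimage e₁ e₁.injective.injOn)
      (mem_restrict.2 (by rwa [h.map_preimage_left hT]) : j ∈ _)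
    rwa [mem_restrict, h.map_preimage_left hT] at this
  · obtain ⟨j, rfl⟩ := (h.notMem_iff i).1 (notMem_of_le_facet hf hT hi)
    have := h₂ ((T \ S).preimage e₂ e₂.injective.injOn)
      (mem_contract.2 ⟨T, (h.map_preimage_right T).symm, hi⟩ : j ∈ _)
    obtain ⟨T', hT', hj⟩ := mem_contract.1 this
    rw [h.map_preimage_right] at hT'
    -- The contraction only provides some `T'` with the same part outside `S` as `T`. Since `g`
    -- chooses from `T` outside `S`, its choice `c` lies in `T'`, and WARP carries the element back
    -- to `T`.
    obtain ⟨c, hc⟩ := g.nonempty (f.mem_sets hi)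
    have hcT : c ∈ T' \ S :=
      hT' ▸ Finset.mem_sdiff.2 ⟨g.subset T hc, notMem_of_le_facet hg hT hc⟩
    exact g.warp hj (f.subset T hi) hc (Finset.mem_sdiff.1 hcT).1

/-- The two choice functions are glued: `f₁` decides on sets inside `S`, and `f₂` decides on `T \ S`
for the others. -/
theorem exists_restrict_contract (h : IsSplit B S B₁ B₂ e₁ e₂) (f₁ : B₁.Choice)
    (f₂ : B₂.Choice) :
    ∃ (f : B.Choice) (hf : f ≤ facet B S), restrict h f = f₁ ∧ contract h f hf = f₂ := by
  classical
  have hne : ∀ j k, e₁ j ≠ e₂ k := fun j k hjk =>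
    (h.notMem_iff _).2 ⟨k, rfl⟩ ((h.mem_iff _).2 ⟨j, hjk⟩)
  let c : Finset V → Finset V := fun T => if T ∈ B.sets then
    (if T ⊆ S then (f₁.1 (T.preimage e₁ e₁.injective.injOn)).map e₁
      else (f₂.1 ((T \ S).preimage e₂ e₂.injective.injOn)).map e₂) else ∅
  have c1 : ∀ T ∈ B.sets, T ⊆ S → c T = (f₁.1 (T.preimage e₁ e₁.injective.injOn)).map e₁ :=
    fun T hT hTS => by simp only [c, hT, hTS, if_true]
  have c2 : ∀ T ∈ B.sets, ¬ T ⊆ S →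
      c T = (f₂.1 ((T \ S).preimage e₂ e₂.injective.injOn)).map e₂ :=
    fun T hT hTS => by simp only [c, hT, hTS, if_true, if_false]
  have c0 : ∀ T, T ∉ B.sets → c T = ∅ := fun T hT => if_neg hT
  have cB : ∀ T i, i ∈ c T → T ∈ B.sets := fun T i hi => by
    by_contra hT; rw [c0 T hT] at hi; simp at hi
  have cS : ∀ T i, i ∈ c T → i ∈ T ∧ (i ∈ S → T ⊆ S) := by
    intro T i hi
    by_cases hTS : T ⊆ S
    · rw [c1 T (cB T i hi) hTS] at hi
      obtain ⟨j, hj, rfl⟩ := Finset.mem_map.1 hi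
      exact ⟨Finset.mem_preimage.1 (f₁.subset _ hj), fun _ => hTS⟩
    · rw [c2 T (cB T i hi) hTS] at hi
      obtain ⟨j, hj, rfl⟩ := Finset.mem_map.1 hi
      have := Finset.mem_sdiff.1 (Finset.mem_preimage.1 (f₂.subset _ hj))
      exact ⟨this.1, fun h' => absurd h' this.2⟩
  let f : B.Choice := by
    refine ⟨c, c0, fun T hT => ?_, fun T i hi => (cS T i hi).1, fun T U i j hi hiU hj hjT => ?_⟩
    · by_cases hTS : T ⊆ S
      · rw [c1 T hT hTS, Finset.map_nonempty]
        refine f₁.nonempty ((h.mem_left _).2 ?_)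
        rwa [h.map_preimage_left hTS]
      · rw [c2 T hT hTS, Finset.map_nonempty]
        exact f₂.nonempty ((h.mem_right _).2 ⟨T, hT, hTS, (h.map_preimage_right T).symm⟩)
    · have hT := cB T i hi
      have hU := cB U j hj
      by_cases hTS : T ⊆ S
      · have hUS := (cS U j hj).2 (hTS hjT)
        rw [c1 T hT hTS] at hi
        rw [c1 U hU hUS] at hj ⊢
        obtain ⟨i', hi', rfl⟩ := Finset.mem_map.1 hi
        obtain ⟨j', hj', rfl⟩ := Finset.mem_map.1 hj
        exact Finset.mem_map_of_mem _
          (f₁.warp hi' (Finset.mem_preimage.2 hiU) hj' (Finset.mem_preimage.2 hjT))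
      · have hiS : i ∉ S := fun h' => hTS ((cS T i hi).2 h')
        have hUS : ¬ U ⊆ S := fun h' => hiS (h' hiU)
        have hjS : j ∉ S := fun h' => hUS ((cS U j hj).2 h')
        rw [c2 T hT hTS] at hi
        rw [c2 U hU hUS] at hj ⊢
        obtain ⟨i', hi', rfl⟩ := Finset.mem_map.1 hi
        obtain ⟨j', hj', rfl⟩ := Finset.mem_map.1 hj
        exact Finset.mem_map_of_mem _ (f₂.warp hi'
          (Finset.mem_preimage.2 (Finset.mem_sdiff.2 ⟨hiU, hiS⟩)) hj'
          (Finset.mem_preimage.2 (Finset.mem_sdiff.2 ⟨hjT, hjS⟩)))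
  refine ⟨f, le_facet_iff.2 fun T i hi => (cS T i hi).2, ?_, ?_⟩
  · refine Subtype.ext (funext fun T => Finset.ext fun j => ?_)
    have hTS : T.map e₁ ⊆ S := by
      intro i hi
      obtain ⟨k, -, rfl⟩ := Finset.mem_map.1 hi
      exact (h.mem_iff _).2 ⟨k, rfl⟩
    rw [mem_restrict]
    change e₁ j ∈ c _ ↔ _
    by_cases hT : T.map e₁ ∈ B.sets
    · rw [c1 _ hT hTS, Finset.mem_map', Finset.preimage_map]
    · rw [c0 _ hT, f₁.2.1 T fun h' => hT ((h.mem_left T).1 h')]; simp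
  · refine Subtype.ext (funext fun U => Finset.ext fun j => ?_)
    rw [mem_contract]
    constructor
    · rintro ⟨T, hTU, hj⟩
      change e₂ j ∈ c T at hj
      have hjS := (h.notMem_iff (e₂ j)).2 ⟨j, rfl⟩
      rw [c2 T (cB T _ hj) fun h' => hjS (h' (cS T _ hj).1), Finset.mem_map', hTU,
        Finset.preimage_map] at hj
      exact hj
    · intro hj
      obtain ⟨T, hT, hTS, hTU⟩ := (h.mem_right U).1 (f₂.mem_sets hj)
      refine ⟨T, hTU, ?_⟩
      change e₂ j ∈ c T
      rwa [c2 T hT hTS, Finset.mem_map', hTU, Finset.preimage_map]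

end Choice

/-- The faces of a facet of a nestohedron. -/
noncomputable def IsSplit.iicIso (h : IsSplit B S B₁ B₂ e₁ e₂) :
    Set.Iic (Choice.facet B S) ≃o B₁.Choice × B₂.Choice where
  toEquiv := Equiv.ofBijective
    (fun f => (Choice.restrict h f.1, Choice.contract h f.1 f.2)) (by
      constructor
      · intro f g hfg
        have h1 : Choice.restrict h f.1 = Choice.restrict h g.1 := congrArg Prod.fst hfg
        have h2 : Choice.contract h f.1 f.2 = Choice.contract h g.1 g.2 := congrArg Prod.snd hfg
        exact Subtype.ext (le_antisymm (Choice.le_of_restrict_contract h1.le h2.le)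
          (Choice.le_of_restrict_contract h1.ge h2.ge))
      · rintro ⟨f₁, f₂⟩
        obtain ⟨f, hf, h1, h2⟩ := Choice.exists_restrict_contract h f₁ f₂
        exact ⟨⟨f, hf⟩, Prod.ext h1 h2⟩)
  map_rel_iff' := by
    rintro ⟨f, hf⟩ ⟨g, hg⟩
    constructor
    · rintro ⟨h1, h2⟩
      exact Choice.le_of_restrict_contract (h := h) (hf := hf) (hg := hg) h1 h2
    · intro hfg
      exact ⟨Choice.restrict_mono h hfg, Choice.contract_mono h (hf := hf) (hg := hg) hfg⟩

/-- A facet of a nestohedron is a product of two nestohedra. -/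
theorem IsSplit.cls_facet [Nonempty V] [Nonempty V₁] [Nonempty V₂]
    (h : IsSplit B S B₁ B₂ e₁ e₂) :
    (B.faceIsoChoice.symm (Choice.facet B S)).toPolytope.cls =
      B₁.nestohedron.cls * B₂.nestohedron.cls := by
  rw [← Polytope.cls_prod]
  refine Polytope.cls_eq_of_iso ?_
  refine (Polytope.faceIso _).trans
    ((Polytope.iicIso B.faceIsoChoice.symm (Choice.facet B S)).symm.trans (h.iicIso.trans ?_))
  exact (Polytope.prodIso B₁.faceIsoChoice.symm B₂.faceIsoChoice.symm).trans
    (Polytope.prodFaceIso _ _).symm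

end Product

end BuildingSet

/-! ### Dimension and simplicity -/

namespace BuildingSet

variable {V : Type} [Fintype V] [DecidableEq V] {B : BuildingSet V}

-- For single-valued `f`, a facet `S` above `f` is the preference set of the element chosen from
-- `S`. These sets are distinct, since `i` is the only element chosen from `f.prefSet i`; the
-- element `c` chosen from the whole set is excluded because its preference set is everything.
open Classical in
theorem Choice.card_facets (f : B.Choice) (hV : Finset.univ ∈ B.sets)
    (hf : ∀ T i j, i ∈ f.1 T → j ∈ f.1 T → i = j) :
    ((B.sets.erase Finset.univ).filter fun S => f ≤ facet B S).card + 1 = Fintype.card V := by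
  obtain ⟨c, hc⟩ := f.nonempty hV
  have key : (B.sets.erase Finset.univ).filter (fun S => f ≤ facet B S) =
      (Finset.univ.erase c).image f.prefSet := by
    ext S
    simp only [Finset.mem_filter, Finset.mem_erase, Finset.mem_image, Finset.mem_univ, and_true]
    constructor
    · rintro ⟨⟨hS, hSB⟩, hle⟩
      rw [le_facet_iff] at hle
      obtain ⟨i, hi⟩ := f.nonempty hSB
      refine ⟨i, ?_, subset_antisymm ?_ ?_⟩
      · rintro rfl
        exact hS (Finset.univ_subset_iff.1 (hle _ i hc (f.subset S hi)))
      · exact hle _ i (f.mem_choice_prefSet i) (f.subset S hi)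
      · exact fun j hj => mem_prefSet.2 ⟨S, hi, hj⟩
    · rintro ⟨i, hi, rfl⟩
      refine ⟨⟨fun h => hi ?_, f.prefSet_mem i⟩, f.le_facet_prefSet i⟩
      have := f.mem_choice_prefSet i
      rw [h] at this
      exact hf _ i c this hc
  rw [key, Finset.card_image_of_injective, Finset.card_erase_of_mem (Finset.mem_univ c),
    Finset.card_univ]
  · exact Nat.sub_add_cancel (Fintype.card_pos_iff.2 ⟨c⟩)
  · intro i j h
    have h1 := f.mem_choice_prefSet i
    rw [h] at h1
    exact hf _ i j h1 (f.mem_choice_prefSet j)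

/-- The points of the nestohedron, as points of `V → ℝ`. -/
def points (B : BuildingSet V) : Set (V → ℝ) := B.nestohedron.carrier

/-- Two selections that differ only in the element taken from the whole set give points with this
difference. -/
theorem single_sub_single_mem [Nonempty V] (hV : Finset.univ ∈ B.sets) (i j : V) :
    (Pi.single i 1 - Pi.single j 1 : V → ℝ) ∈
      vectorSpan ℝ B.points := by
  obtain ⟨s, hs⟩ := (⊤ : B.Choice).exists_selection
  have hs' : B.IsSelection s := fun T hT => Choice.subset _ T (hs T hT)
  have hi : B.selPoint _ ∈ B.points := selPoint_mem (hs'.update (Finset.mem_univ i))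
  have hj : B.selPoint _ ∈ B.points := selPoint_mem (hs'.update (Finset.mem_univ j))
  have h := vsub_mem_vectorSpan ℝ hi hj
  have e : B.selPoint (Function.update s Finset.univ i) -
      B.selPoint (Function.update s Finset.univ j) = Pi.single i 1 - Pi.single j 1 := by
    rw [selPoint_update s hV, selPoint_update s hV]; abel
  rw [← e]; exact h

/-- Every generating point has coordinate sum `B.sets.card`; conversely, a vector of coordinate sum
zero is a combination of differences of unit vectors. -/
theorem vectorSpan_eq [Nonempty V] (hV : Finset.univ ∈ B.sets) :
    vectorSpan ℝ B.points =
      LinearMap.ker (linForm (1 : V → ℝ)) := by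
  apply le_antisymm
  · have hc : B.points ⊆
        {x | linForm (1 : V → ℝ) x = (B.sets.card : ℝ)} := by
      rw [points, carrier_eq]
      refine convexHull_min ?_ (convex_hyperplane (linForm (1 : V → ℝ)).isLinear _)
      intro x hx
      obtain ⟨s, hs, rfl⟩ := mem_sum_simplexVertices.1 hx
      change linForm _ _ = _
      rw [linForm_apply, sum_weight_selPoint]
      simp
    rw [vectorSpan_def, Submodule.span_le]
    rintro _ ⟨x, hx, y, hy, rfl⟩
    change linForm (1 : V → ℝ) (x - y) = 0
    rw [map_sub, hc hx, hc hy, sub_self]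
  · intro x hx
    rw [LinearMap.mem_ker, linForm_apply] at hx
    simp only [Pi.one_apply, one_mul] at hx
    let k : V := Classical.arbitrary V
    have : x = ∑ i, x i • (Pi.single i 1 - Pi.single k 1 : V → ℝ) := by
      simp only [smul_sub, Finset.sum_sub_distrib, ← Finset.sum_smul, hx, zero_smul, sub_zero]
      exact pi_eq_sum_univ' x
    rw [this]
    exact Submodule.sum_mem _ fun i _ => Submodule.smul_mem _ _ (single_sub_single_mem hV i k)

theorem dim_nestohedron [Nonempty V] (hV : Finset.univ ∈ B.sets) :
    B.nestohedron.dim + 1 = Fintype.card V := by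
  have h : linForm (1 : V → ℝ) ≠ 0 := by
    intro h
    have := LinearMap.congr_fun h (Pi.single (Classical.arbitrary V) 1)
    simp [linForm_apply] at this
  have := Module.Dual.finrank_ker_add_one_of_ne_zero h
  rw [Module.finrank_pi, ← vectorSpan_eq hV] at this
  exact this

/-- Nestohedra of connected building sets are simple. -/
theorem isSimple_nestohedron [Nonempty V] (hV : Finset.univ ∈ B.sets) :
    B.nestohedron.IsSimple := by
  classical
  intro (v : V → ℝ) hv
  let F : B.nestohedron.Face :=
    ⟨{v}, Set.singleton_nonempty v, convex_singleton v, isExtreme_singleton.2 hv⟩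
  -- The choice function of a vertex is single-valued: exchanging one chosen element for another
  -- keeps the point equal to `v`, so the two unit vectors agree.
  have hf : ∀ T i j, i ∈ (toChoice F).1 T → j ∈ (toChoice F).1 T → i = j := by
    intro T i j hi hj
    obtain ⟨hT, s, hs, rfl, hsF⟩ := mem_faceChoice.1 hi
    obtain ⟨-, t, ht, rfl, htF⟩ := mem_faceChoice.1 hj
    have h1 : B.selPoint (Function.update s T (t T)) = v := update_mem_face F hs ht hsF htF hT
    have h2 : B.selPoint s = v := hsF
    rw [selPoint_update s hT, h2] at h1
    have h3 : (Pi.single (t T) 1 : V → ℝ) = Pi.single (s T) 1 := by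
      have h4 : v - Pi.single (s T) 1 + Pi.single (t T) 1 - v + Pi.single (s T) 1 =
        v - v + (Pi.single (s T) 1 : V → ℝ) := by rw [h1]
      have h5 : v - Pi.single (s T) 1 + Pi.single (t T) 1 - v + Pi.single (s T) 1 =
        (Pi.single (t T) 1 : V → ℝ) := by abel
      rw [← h5, h4]; abel
    by_contra hne
    have := congrFun h3 (t T)
    simp [Ne.symm hne] at this
  have hcard : {G : B.nestohedron.Facet | v ∈ G.1.1}.ncard =
      ((B.sets.erase Finset.univ).filter fun S => toChoice F ≤ Choice.facet B S).card := by
    rw [← Set.ncard_coe_finset]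
    refine (Set.ncard_congr (fun S hS => facetEquiv hV ⟨S, ?_⟩) ?_ ?_ ?_).symm
    · simp only [Finset.coe_filter, Finset.mem_erase, Set.mem_ofPred_eq] at hS
      exact ⟨hS.1.2, hS.1.1⟩
    · intro S hS
      have h1 : toChoice F ≤ Choice.facet B S := (Finset.mem_filter.1 hS).2
      have h2 : F ≤ B.faceIsoChoice.symm (Choice.facet B S) :=
        (OrderIso.le_symm_apply _).2 h1
      exact h2 rfl
    · intro S S' hS hS' h
      exact congrArg Subtype.val ((facetEquiv hV).injective h)
    · intro G hG
      obtain ⟨⟨S, h1, h2⟩, rfl⟩ := (facetEquiv hV).surjective G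
      refine ⟨S, ?_, rfl⟩
      rw [Finset.mem_coe, Finset.mem_filter, Finset.mem_erase]
      refine ⟨⟨h2, h1⟩, ?_⟩
      have h3 : F ≤ B.faceIsoChoice.symm (Choice.facet B S) :=
        Set.singleton_subset_iff.2 hG
      exact (OrderIso.le_symm_apply _).1 h3
  have h1 := (toChoice F).card_facets hV hf
  have h2 := dim_nestohedron hV
  refine hcard.trans ?_
  omega

end BuildingSet

/-! ### Building sets of complete graphs and of the joins -/

namespace SimpleGraph

variable {V W V' W' : Type} [Fintype V] [DecidableEq V] [Fintype W] [DecidableEq W]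
  [Fintype V'] [DecidableEq V'] [Fintype W'] [DecidableEq W']

theorem mem_buildingSet {G : SimpleGraph V} {S : Finset V} :
    S ∈ G.buildingSet.sets ↔ S.Nonempty ∧ (G.induce (S : Set V)).Connected := by
  simp [buildingSet]

theorem mem_buildingSet_top {S : Finset V} :
    S ∈ (⊤ : SimpleGraph V).buildingSet.sets ↔ S.Nonempty := by
  rw [mem_buildingSet, and_iff_left_iff_imp]
  rintro ⟨i, hi⟩
  have : Nonempty (S : Set V) := ⟨⟨i, hi⟩⟩
  refine ⟨fun a b => ?_⟩
  by_cases hab : a = b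
  · rw [hab]
  · exact Adj.reachable ((top_adj a.1 b.1).2 fun h => hab (Subtype.ext h))

/-- A node of the complete part is adjacent to every other node, so any set containing one is
connected. Without such a node the induced graph has no edges, and only singletons remain. -/
theorem mem_buildingSet_join {S : Finset (V ⊕ W)} :
    S ∈ ((⊤ : SimpleGraph V).joinGraph (⊥ : SimpleGraph W)).buildingSet.sets ↔
      (∃ i, Sum.inl i ∈ S) ∨ ∃ j, S = {Sum.inr j} := by
  constructor
  · intro hS
    by_contra! h
    obtain ⟨⟨x, hx⟩, hc⟩ := mem_buildingSet.1 hS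
    have hbot : ((⊤ : SimpleGraph V).joinGraph (⊥ : SimpleGraph W)).induce
        (S : Set (V ⊕ W)) = ⊥ := by
      ext ⟨a, ha⟩ ⟨b, hb⟩
      rcases a with a | a
      · exact absurd ha (h.1 a)
      rcases b with b | b
      · exact absurd hb (h.1 b)
      simp [joinGraph]
    rw [hbot] at hc
    have := preconnected_bot_iff_subsingleton.1 hc.preconnected
    rcases x with x | x
    · exact h.1 x hx
    · refine h.2 x (Finset.eq_singleton_iff_unique_mem.2 ⟨hx, fun y hy => ?_⟩)
      exact congrArg Subtype.val (Subsingleton.elim (⟨y, hy⟩ : (S : Set (V ⊕ W))) ⟨_, hx⟩)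
  · rintro (⟨i, hi⟩ | ⟨j, rfl⟩)
    · refine mem_buildingSet.2 ⟨⟨_, hi⟩, ?_⟩
      have hr : ∀ x : (S : Set (V ⊕ W)),
          (((⊤ : SimpleGraph V).joinGraph (⊥ : SimpleGraph W)).induce
            (S : Set (V ⊕ W))).Reachable ⟨_, hi⟩ x := by
        rintro ⟨x, hx⟩
        by_cases hxi : x = Sum.inl i
        · subst hxi; rfl
        · refine Adj.reachable ?_
          rcases x with x | x
          · have hne : i ≠ x := fun h => hxi (by rw [h])
            simp [joinGraph, hne]
          · simp [joinGraph]
      have : Nonempty (S : Set (V ⊕ W)) := ⟨⟨_, hi⟩⟩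
      exact ⟨fun a b => (hr a).symm.trans (hr b)⟩
    · exact BuildingSet.singleton_mem _ _

theorem map_mem_buildingSet_join (e : V' ↪ V) (e' : W' ↪ W) {T : Finset (V' ⊕ W')} :
    T.map (e.sumMap e') ∈
        ((⊤ : SimpleGraph V).joinGraph (⊥ : SimpleGraph W)).buildingSet.sets ↔
      T ∈ ((⊤ : SimpleGraph V').joinGraph (⊥ : SimpleGraph W')).buildingSet.sets := by
  rw [mem_buildingSet_join, mem_buildingSet_join]
  refine or_congr ?_ ?_
  · constructor
    · rintro ⟨i, hi⟩
      obtain ⟨x | x, hx, h⟩ := Finset.mem_map.1 hi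
      · exact ⟨x, hx⟩
      · simp at h
    · rintro ⟨i, hi⟩
      exact ⟨e i, Finset.mem_map_of_mem (e.sumMap e') hi⟩
  · constructor
    · rintro ⟨j, hj⟩
      obtain ⟨x, hx, h⟩ := Finset.mem_map.1 (hj ▸ Finset.mem_singleton_self (Sum.inr j))
      rcases x with x | x
      · simp at h
      · refine ⟨x, Finset.eq_singleton_iff_unique_mem.2 ⟨hx, fun y hy => ?_⟩⟩
        have := Finset.mem_map_of_mem (e.sumMap e') hy
        rw [hj, Finset.mem_singleton, ← h] at this
        exact (e.sumMap e').injective this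
    · rintro ⟨j, rfl⟩
      exact ⟨e' j, by simp⟩

/-- The contraction is complete because adding `S`, with its node `i₀`, makes any nonempty set of
outside nodes connected. -/
theorem isSplit_join_of_inl {Z : Type} [Fintype Z] [DecidableEq Z] {S : Finset (V ⊕ W)}
    (e : V' ↪ V) (e' : W' ↪ W) (e₂ : Z ↪ V ⊕ W) {i₀ : V} (hi₀ : Sum.inl i₀ ∈ S)
    (h₁ : ∀ i, i ∈ S ↔ ∃ j, e.sumMap e' j = i) (h₂ : ∀ i, i ∉ S ↔ ∃ j, e₂ j = i) :
    ((⊤ : SimpleGraph V).joinGraph (⊥ : SimpleGraph W)).buildingSet.IsSplit S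
      ((⊤ : SimpleGraph V').joinGraph (⊥ : SimpleGraph W')).buildingSet
      (⊤ : SimpleGraph Z).buildingSet (e.sumMap e') e₂ where
  mem_iff := h₁
  notMem_iff := h₂
  mem_left _ := (map_mem_buildingSet_join e e').symm
  mem_right U := by
    rw [mem_buildingSet_top]
    constructor
    · rintro ⟨j, hj⟩
      have hd : Disjoint (U.map e₂) S := by
        rw [Finset.disjoint_left]
        intro i hi
        obtain ⟨k, -, rfl⟩ := Finset.mem_map.1 hi
        exact (h₂ _).2 ⟨k, rfl⟩
      refine ⟨U.map e₂ ∪ S, mem_buildingSet_join.2 (Or.inl ⟨i₀, Finset.mem_union_right _ hi₀⟩),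
        fun h => ?_, by rw [Finset.union_sdiff_right, hd.sdiff_eq_left]⟩
      exact (h₂ _).2 ⟨j, rfl⟩ (h (Finset.mem_union_left _ (Finset.mem_map_of_mem e₂ hj)))
    · rintro ⟨T, -, hT, hTU⟩
      rw [← Finset.map_nonempty (f := e₂), ← hTU]
      exact Finset.sdiff_nonempty.2 hT

/-- Contracting a node of the edgeless part amounts to deleting it: sets meeting the complete part
still do so after removal, and the other singletons are unaffected. -/
theorem isSplit_join_singleton {Z : Type} [Fintype Z] [DecidableEq Z] [Unique Z]
    (e' : W' ↪ W) {j : W} (h : ∀ i, i ≠ j ↔ ∃ k, e' k = i) (e₁ : Z ↪ V ⊕ W)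
    (he₁ : e₁ default = Sum.inr j) :
    ((⊤ : SimpleGraph V).joinGraph (⊥ : SimpleGraph W)).buildingSet.IsSplit {Sum.inr j}
      (⊤ : SimpleGraph Z).buildingSet
      ((⊤ : SimpleGraph V).joinGraph (⊥ : SimpleGraph W')).buildingSet
      e₁ ((Function.Embedding.refl V).sumMap e') := by
  have hc : ∀ i : V ⊕ W, i ∉ ({Sum.inr j} : Finset (V ⊕ W)) ↔
      ∃ k, (Function.Embedding.refl V).sumMap e' k = i := by
    rintro (i | i)
    · simp
    · simp [h]
  refine ⟨fun i => ?_, hc, fun T => ?_, fun U => ?_⟩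
  · rw [Finset.mem_singleton]
    constructor
    · rintro rfl; exact ⟨_, he₁⟩
    · rintro ⟨k, rfl⟩; rw [Subsingleton.elim k default, he₁]
  · rw [mem_buildingSet_top]
    constructor
    · intro hT
      refine mem_buildingSet_join.2 (Or.inr ⟨j, ?_⟩)
      have : T = {default} := Finset.eq_singleton_iff_nonempty_unique_mem.2
        ⟨hT, fun _ _ => Subsingleton.elim _ _⟩
      rw [this]
      simp [he₁]
    · intro hT
      exact Finset.map_nonempty.1 (BuildingSet.nonempty_of_mem _ _ hT)
  · rw [← map_mem_buildingSet_join (Function.Embedding.refl V) e']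
    constructor
    · intro hU
      have hd : Disjoint (U.map ((Function.Embedding.refl V).sumMap e')) {Sum.inr j} := by
        rw [Finset.disjoint_left]
        intro i hi
        obtain ⟨k, -, rfl⟩ := Finset.mem_map.1 hi
        exact (hc _).2 ⟨k, rfl⟩
      refine ⟨_, hU, fun h => ?_, hd.sdiff_eq_left⟩
      obtain ⟨x, hx⟩ := BuildingSet.nonempty_of_mem _ _ hU
      exact Finset.disjoint_left.1 hd hx (h hx)
    · rintro ⟨T, hT, hTS, hTU⟩
      rw [← hTU]
      rcases mem_buildingSet_join.1 hT with ⟨i, hi⟩ | ⟨k, rfl⟩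
      · exact mem_buildingSet_join.2 (Or.inl ⟨i, by simp [hi]⟩)
      · have : ({Sum.inr k} : Finset (V ⊕ W)) \ {Sum.inr j} = {Sum.inr k} := by
          refine Finset.sdiff_eq_self_of_disjoint (Finset.disjoint_singleton.2 fun h => ?_)
          exact hTS (by rw [h])
        rw [this]; exact hT

end SimpleGraph

/-! ### Simplicity of the two families and the facet sum of the joins -/

theorem isSimple_completeEmptyNestohedron {k l : ℕ} (hk : 1 ≤ k) :
    (completeEmptyNestohedron k l).IsSimple := by
  have : Nonempty (Fin k ⊕ Fin l) := ⟨Sum.inl ⟨0, hk⟩⟩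
  exact BuildingSet.isSimple_nestohedron
    (SimpleGraph.mem_buildingSet_join.2 (Or.inl ⟨⟨0, hk⟩, Finset.mem_univ _⟩))

theorem isSimple_permutohedron (n : ℕ) : (permutohedron n).IsSimple :=
  BuildingSet.isSimple_nestohedron (SimpleGraph.mem_buildingSet_top.2 Finset.univ_nonempty)

/-- On a one-element set any two choice functions coincide, so there is a single nonempty face. -/
theorem cls_permutohedron_zero : (permutohedron 0).cls = 1 := by
  let B := (⊤ : SimpleGraph (Fin 1)).buildingSet
  have hs : ∀ F G : (permutohedron 0).Face, F = G := fun F G =>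
    B.faceIsoChoice.injective (BuildingSet.Choice.eq_of_subsingleton _ _)
  have e : (permutohedron 0).Face ≃o Polytope.point.Face :=
    { toFun := fun _ => ⊤
      invFun := fun _ => ⊤
      left_inv := fun _ => hs _ _
      right_inv := fun _ => Subsingleton.elim _ _
      map_rel_iff' := fun {F G} => ⟨fun _ => (hs F G).le, fun _ => le_rfl⟩ }
  exact (Polytope.cls_eq_of_iso e).trans (MonoidAlgebra.of ℚ CombPolytope).map_one

/-- The class of `completeEmptyNestohedron a b` if `1 ≤ a`, and zero otherwise. -/
noncomputable def completeEmptyClass (a b : ℕ) : PolytopeRing :=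
  if 1 ≤ a then (completeEmptyNestohedron a b).cls else 0

/-- The class of the nestohedron of the complete graph on `m` nodes if `1 ≤ m`, and zero
otherwise. -/
noncomputable def completeClass : ℕ → PolytopeRing
  | 0 => 0
  | n + 1 => (permutohedron n).cls

theorem cls_facet_of_inl {k l : ℕ} [Nonempty (Fin k ⊕ Fin l)] {S : Finset (Fin k ⊕ Fin l)}
    {i : Fin k} (hi : Sum.inl i ∈ S) (hS : S ≠ Finset.univ) :
    ((BuildingSet.faceIsoChoice _).symm (BuildingSet.Choice.facet
      ((⊤ : SimpleGraph (Fin k)).joinGraph (⊥ : SimpleGraph (Fin l))).buildingSet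
        S)).toPolytope.cls =
      completeEmptyClass S.toLeft.card S.toRight.card *
        completeClass (k - S.toLeft.card + (l - S.toRight.card)) := by
  have hpos : 1 ≤ S.toLeft.card := Finset.card_pos.2 ⟨i, Finset.mem_toLeft.2 hi⟩
  have hcard : Sᶜ.card = k - S.toLeft.card + (l - S.toRight.card) := by
    have h1 := S.card_toLeft_add_card_toRight
    have h2 : S.toLeft.card ≤ k := by simpa using Finset.card_le_univ S.toLeft
    have h3 : S.toRight.card ≤ l := by simpa using Finset.card_le_univ S.toRight
    rw [Finset.card_compl, Fintype.card_sum, Fintype.card_fin, Fintype.card_fin]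
    omega
  have hne : Sᶜ.card ≠ 0 := fun h =>
    hS ((Finset.compl_eq_empty_iff S).1 (Finset.card_eq_zero.1 h))
  -- The complement has `n + 1` nodes, so its complete graph gives `permutohedron n`; properness of
  -- `S` excludes the zero value of `completeClass`.
  obtain ⟨n, hn⟩ := Nat.exists_eq_succ_of_ne_zero hne
  rw [← hcard, hn, completeEmptyClass, if_pos hpos]
  have : Nonempty (Fin S.toLeft.card ⊕ Fin S.toRight.card) := ⟨Sum.inl ⟨0, hpos⟩⟩
  refine (SimpleGraph.isSplit_join_of_inl (S.toLeft.orderEmbOfFin rfl).toEmbedding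
    (S.toRight.orderEmbOfFin rfl).toEmbedding
    ((Finset.equivFinOfCardEq hn).symm.toEmbedding.trans (Function.Embedding.subtype _))
    hi ?_ ?_).cls_facet
  · rintro (x | x)
    · rw [← Finset.mem_toLeft, ← Finset.mem_coe, ← S.toLeft.range_orderEmbOfFin rfl]
      simp [-Finset.range_orderEmbOfFin]
    · rw [← Finset.mem_toRight, ← Finset.mem_coe, ← S.toRight.range_orderEmbOfFin rfl]
      simp [-Finset.range_orderEmbOfFin]
  · intro x
    rw [← Finset.mem_compl]
    constructor
    · intro hx
      exact ⟨Finset.equivFinOfCardEq hn ⟨x, hx⟩, by simp⟩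
    · rintro ⟨j, rfl⟩
      exact ((Finset.equivFinOfCardEq hn).symm j).2

theorem cls_facet_singleton {k l : ℕ} (hk : 1 ≤ k) [Nonempty (Fin k ⊕ Fin (l + 1))]
    (j : Fin (l + 1)) :
    ((BuildingSet.faceIsoChoice _).symm (BuildingSet.Choice.facet
      ((⊤ : SimpleGraph (Fin k)).joinGraph (⊥ : SimpleGraph (Fin (l + 1)))).buildingSet
        {Sum.inr j})).toPolytope.cls = completeEmptyClass k l := by
  have : Nonempty (Fin k ⊕ Fin l) := ⟨Sum.inl ⟨0, hk⟩⟩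
  have h := (SimpleGraph.isSplit_join_singleton (V := Fin k) (Z := Fin 1)
    (Fin.succAboveEmb j) (j := j) (fun i => by simp [Fin.exists_succAbove_eq_iff])
    ⟨fun _ => Sum.inr j, fun _ _ _ => Subsingleton.elim _ _⟩ rfl).cls_facet
  rw [completeEmptyClass, if_pos hk]
  refine h.trans ?_
  change (permutohedron 0).cls * _ = _
  rw [cls_permutohedron_zero, one_mul]
  rfl

/-- The first term comes from the `l` singletons of the edgeless part, the double sum from the
proper sets meeting the complete part, grouped by their numbers `a` and `b` of nodes of each kind.
For `l = 0` the truncated `l - 1` carries coefficient zero. -/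
theorem facetSum_completeEmptyNestohedron {k l : ℕ} (hk : 1 ≤ k) :
    (completeEmptyNestohedron k l).facetSum = l • completeEmptyClass k (l - 1) +
      ∑ a ∈ Finset.range (k + 1), ∑ b ∈ Finset.range (l + 1),
        (k.choose a * l.choose b) •
          (completeEmptyClass a b * completeClass (k - a + (l - b))) := by
  classical
  have hne : Nonempty (Fin k ⊕ Fin l) := ⟨Sum.inl ⟨0, hk⟩⟩
  set B := ((⊤ : SimpleGraph (Fin k)).joinGraph (⊥ : SimpleGraph (Fin l))).buildingSet with hB
  have hV : Finset.univ ∈ B.sets :=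
    SimpleGraph.mem_buildingSet_join.2 (Or.inl ⟨⟨0, hk⟩, Finset.mem_univ _⟩)
  have hsets : B.sets.erase Finset.univ =
      (Finset.univ.image fun j : Fin l => ({Sum.inr j} : Finset (Fin k ⊕ Fin l))) ∪
      Finset.univ.filter fun S => (∃ i, Sum.inl i ∈ S) ∧ S ≠ Finset.univ := by
    ext S
    rw [Finset.mem_erase, hB, SimpleGraph.mem_buildingSet_join]
    simp only [Finset.mem_union, Finset.mem_image, Finset.mem_univ, true_and, Finset.mem_filter]
    constructor
    · rintro ⟨h, h' | ⟨j, rfl⟩⟩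
      · exact Or.inr ⟨h', h⟩
      · exact Or.inl ⟨j, rfl⟩
    · rintro (⟨j, rfl⟩ | ⟨h', h⟩)
      · refine ⟨fun h => ?_, Or.inr ⟨j, rfl⟩⟩
        have := Finset.mem_univ (Sum.inl ⟨0, hk⟩ : Fin k ⊕ Fin l)
        rw [← h] at this
        simp at this
      · exact ⟨h, Or.inl h'⟩
  have hdisj : Disjoint
      (Finset.univ.image fun j : Fin l => ({Sum.inr j} : Finset (Fin k ⊕ Fin l)))
      (Finset.univ.filter fun S => (∃ i, Sum.inl i ∈ S) ∧ S ≠ Finset.univ) := by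
    rw [Finset.disjoint_left]
    intro S hS hS'
    obtain ⟨j, -, rfl⟩ := Finset.mem_image.1 hS
    obtain ⟨-, ⟨i, hi⟩, -⟩ := Finset.mem_filter.1 hS'
    simp at hi
  refine (BuildingSet.facetSum_eq hV).trans ?_
  rw [hsets, Finset.sum_union hdisj]
  congr 1
  · rw [Finset.sum_image fun i _ j _ h => by simpa using h]
    cases l with
    | zero => simp
    | succ l =>
      rw [Finset.sum_congr rfl fun j _ => cls_facet_singleton hk j]
      simp
  · have h1 : ∀ S ∈ Finset.univ.filter
        fun S : Finset (Fin k ⊕ Fin l) => (∃ i, Sum.inl i ∈ S) ∧ S ≠ Finset.univ,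
        (B.faceIsoChoice.symm (BuildingSet.Choice.facet B S)).toPolytope.cls =
        completeEmptyClass S.toLeft.card S.toRight.card *
          completeClass (k - S.toLeft.card + (l - S.toRight.card)) := by
      intro S hS
      obtain ⟨-, ⟨i, hi⟩, h⟩ := Finset.mem_filter.1 hS
      exact cls_facet_of_inl hi h
    -- The sum may run over all subsets: the whole set contributes `completeClass 0 = 0`, and sets
    -- missing the complete part contribute `completeEmptyClass 0 _ = 0`.
    rw [Finset.sum_congr rfl h1, Finset.sum_subset (Finset.subset_univ _)]
    · rw [← Finset.sumEquiv.symm.toEquiv.sum_comp]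
      simp only [RelIso.coe_fn_toEquiv, Finset.sumEquiv_symm_apply, Finset.toLeft_disjSum,
        Finset.toRight_disjSum]
      rw [Fintype.sum_prod_type]
      -- A subset is now a pair of subsets; the summand depends only on their sizes, which produces
      -- the binomial coefficients.
      have h2 := Finset.sum_powerset_apply_card (x := (Finset.univ : Finset (Fin k)))
        fun a => ∑ C : Finset (Fin l), completeEmptyClass a C.card *
          completeClass (k - a + (l - C.card))
      rw [Finset.powerset_univ] at h2
      rw [h2, Finset.card_univ, Fintype.card_fin]
      refine Finset.sum_congr rfl fun a _ => ?_
      have h3 := Finset.sum_powerset_apply_card (x := (Finset.univ : Finset (Fin l)))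
        fun b => completeEmptyClass a b * completeClass (k - a + (l - b))
      rw [Finset.powerset_univ] at h3
      rw [h3, Finset.card_univ, Fintype.card_fin, Finset.smul_sum]
      exact Finset.sum_congr rfl fun b _ => smul_smul _ _ _
    · intro S _ hS
      by_cases h : S = Finset.univ
      · subst h
        have h1 : (Finset.univ : Finset (Fin k ⊕ Fin l)).toLeft = Finset.univ := by
          ext; simp
        have h2 : (Finset.univ : Finset (Fin k ⊕ Fin l)).toRight = Finset.univ := by
          ext; simp
        rw [h1, h2]
        simp [completeClass]
      · have : S.toLeft = ∅ := by
          rw [Finset.eq_empty_iff_forall_notMem]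
          intro i hi
          exact hS (Finset.mem_filter.2 ⟨Finset.mem_univ _, ⟨i, Finset.mem_toLeft.1 hi⟩, h⟩)
        simp [this, completeEmptyClass]

/-! ### Coefficients of the generating functions -/

theorem coeff_X_add_X_pow {R : Type*} [CommRing R] (m : Fin 2 →₀ ℕ) (d : ℕ) :
    MvPowerSeries.coeff m ((MvPowerSeries.X 0 + MvPowerSeries.X 1 :
      MvPowerSeries (Fin 2) R) ^ d) =
      if d = m 0 + m 1 then (d.choose (m 0) : R) else 0 := by
  have h2 : ∀ i j : ℕ, m = Finsupp.single 0 i + Finsupp.single 1 j ↔ m 0 = i ∧ m 1 = j := by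
    intro i j
    rw [Finsupp.ext_iff, Fin.forall_fin_two]
    simp
  have key : ∀ x ∈ Finset.range (d + 1), MvPowerSeries.coeff m
      ((MvPowerSeries.X 0 : MvPowerSeries (Fin 2) R) ^ x * MvPowerSeries.X 1 ^ (d - x) *
        (d.choose x : MvPowerSeries (Fin 2) R)) =
      if x = m 0 then (if d = m 0 + m 1 then (d.choose (m 0) : R) else 0) else 0 := by
    intro x hx
    have hx' := Finset.mem_range.1 hx
    rw [← map_natCast (MvPowerSeries.C (σ := Fin 2) (R := R)), MvPowerSeries.coeff_mul_C,
      MvPowerSeries.X_pow_eq, MvPowerSeries.X_pow_eq, MvPowerSeries.monomial_mul_monomial,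
      MvPowerSeries.coeff_monomial]
    simp only [h2, ← ite_and]
    by_cases h : m 0 = x ∧ m 1 = d - x
    · rw [if_pos h, if_pos ⟨h.1.symm, by omega⟩, h.1]; simp
    · rw [if_neg h, if_neg fun h' => h ⟨h'.1.symm, by omega⟩]; simp
  rw [add_pow, map_sum, Finset.sum_congr rfl key, Finset.sum_ite_eq']
  by_cases h : d = m 0 + m 1
  · rw [if_pos (Finset.mem_range.2 (by omega))]
  · simp [h]

theorem coeff_permutohedronSeries (d : ℕ) :
    PowerSeries.coeff d permutohedronSeries = ((d ! : ℚ)⁻¹) • completeClass d := by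
  rw [permutohedronSeries, PowerSeries.coeff_mk]
  cases d with
  | zero => simp [completeClass]
  | succ n => rfl

/-- Only the power of total degree `m 0 + m 1` contributes, and its binomial coefficient turns `1 /
(m 0 + m 1)!` into `1 / ((m 0)! (m 1)!)`. -/
theorem coeff_subst_permutohedronSeries (m : Fin 2 →₀ ℕ) :
    MvPowerSeries.coeff m (PowerSeries.subst (MvPowerSeries.X 0 + MvPowerSeries.X 1 :
      MvPowerSeries (Fin 2) PolytopeRing) permutohedronSeries) =
      (((m 0)! : ℚ)⁻¹ * ((m 1)! : ℚ)⁻¹) • completeClass (m 0 + m 1) := by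
  rw [PowerSeries.coeff_subst (PowerSeries.HasSubst.of_constantCoeff_zero (by simp)),
    finsum_eq_single _ (m 0 + m 1)]
  · rw [coeff_X_add_X_pow, if_pos rfl, coeff_permutohedronSeries, smul_eq_mul, smul_mul_assoc,
      mul_comm, ← nsmul_eq_mul, ← Nat.cast_smul_eq_nsmul ℚ, smul_smul]
    congr 1
    have h := Nat.add_choose_mul_factorial_mul_factorial (m 0) (m 1)
    rw [← Nat.choose_symm_add] at h
    have h0 : ((m 0)! : ℚ) ≠ 0 := Nat.cast_ne_zero.2 (Nat.factorial_ne_zero _)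
    have h1 : ((m 1)! : ℚ) ≠ 0 := Nat.cast_ne_zero.2 (Nat.factorial_ne_zero _)
    have h3 : ((m 0 + m 1)! : ℚ) ≠ 0 := Nat.cast_ne_zero.2 (Nat.factorial_ne_zero _)
    field_simp
    rw [← h]
    push_cast
    ring
  · intro d hd
    rw [coeff_X_add_X_pow, if_neg hd, smul_zero]

theorem coeff_completeEmptySeries (m : Fin 2 →₀ ℕ) :
    MvPowerSeries.coeff m completeEmptySeries =
      (((m 0)! : ℚ)⁻¹ * ((m 1)! : ℚ)⁻¹) • completeEmptyClass (m 0) (m 1) := by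
  change (if 1 ≤ m 0 then _ else _) = _
  unfold completeEmptyClass
  split_ifs <;> simp

/-- A sum over the antidiagonal of a bidegree as a double sum. -/
theorem sum_antidiagonal_fin_two {M : Type*} [AddCommMonoid M] (m : Fin 2 →₀ ℕ)
    (f : ℕ → ℕ → ℕ → ℕ → M) :
    ∑ p ∈ Finset.HasAntidiagonal.antidiagonal m, f (p.1 0) (p.1 1) (p.2 0) (p.2 1) =
      ∑ a ∈ Finset.range (m 0 + 1), ∑ b ∈ Finset.range (m 1 + 1),
        f a b (m 0 - a) (m 1 - b) := by
  rw [← Finset.sum_product']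
  refine Finset.sum_bij' (fun p _ => (p.1 0, p.1 1))
    (fun q _ => (Finsupp.single (0 : Fin 2) q.1 + Finsupp.single 1 q.2,
      Finsupp.single 0 (m 0 - q.1) + Finsupp.single 1 (m 1 - q.2))) ?_ ?_ ?_ ?_ ?_
  · rintro ⟨u, v⟩ h
    rw [Finset.HasAntidiagonal.mem_antidiagonal] at h
    subst h
    simp
  · rintro ⟨a, b⟩ h
    simp only [Finset.mem_product, Finset.mem_range] at h
    rw [Finset.HasAntidiagonal.mem_antidiagonal, Finsupp.ext_iff, Fin.forall_fin_two]
    simp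
    omega
  · rintro ⟨u, v⟩ h
    rw [Finset.HasAntidiagonal.mem_antidiagonal] at h
    subst h
    refine Prod.ext ?_ ?_ <;> rw [Finsupp.ext_iff, Fin.forall_fin_two] <;> simp
  · rintro ⟨a, b⟩ _
    simp
  · rintro ⟨u, v⟩ h
    rw [Finset.HasAntidiagonal.mem_antidiagonal] at h
    subst h
    simp

/-- Multiplication by `y` shifts the second exponent, and `1 / (l - 1)! = l / l!`; for `m 1 = 0`
both sides vanish. -/
theorem coeff_completeEmptySeries_mul_X (m : Fin 2 →₀ ℕ) :
    MvPowerSeries.coeff m (completeEmptySeries * MvPowerSeries.X 1) =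
      (((m 0)! : ℚ)⁻¹ * ((m 1)! : ℚ)⁻¹) • (m 1 • completeEmptyClass (m 0) (m 1 - 1)) := by
  rw [MvPowerSeries.X, MvPowerSeries.coeff_mul_monomial, mul_one]
  split_ifs with h
  · have h1 : 1 ≤ m 1 := by simpa using h 1
    rw [coeff_completeEmptySeries, ← Nat.cast_smul_eq_nsmul ℚ, smul_smul]
    obtain ⟨n, hn⟩ := Nat.exists_eq_succ_of_ne_zero (Nat.one_le_iff_ne_zero.1 h1)
    have e0 : (m - Finsupp.single (1 : Fin 2) 1 : Fin 2 →₀ ℕ) 0 = m 0 := by simp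
    have e1 : (m - Finsupp.single (1 : Fin 2) 1 : Fin 2 →₀ ℕ) 1 = n := by simp [hn]
    rw [e0, e1, hn, Nat.succ_sub_one]
    congr 1
    rw [Nat.succ_eq_add_one, Nat.factorial_succ]
    have : ((n + 1 : ℕ) : ℚ) ≠ 0 := Nat.cast_ne_zero.2 n.succ_ne_zero
    have h0 : (n ! : ℚ) ≠ 0 := Nat.cast_ne_zero.2 (Nat.factorial_ne_zero _)
    push_cast at *
    field_simp
  · have h1 : m 1 = 0 := by
      by_contra h1
      exact h (Finsupp.single_le_iff.2 (Nat.one_le_iff_ne_zero.2 h1))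
    simp [h1]

theorem coeff_completeEmptySeries_mul_subst (m : Fin 2 →₀ ℕ) :
    MvPowerSeries.coeff m (completeEmptySeries *
      PowerSeries.subst (MvPowerSeries.X 0 + MvPowerSeries.X 1 :
        MvPowerSeries (Fin 2) PolytopeRing) permutohedronSeries) =
      (((m 0)! : ℚ)⁻¹ * ((m 1)! : ℚ)⁻¹) •
        ∑ a ∈ Finset.range (m 0 + 1), ∑ b ∈ Finset.range (m 1 + 1),
          ((m 0).choose a * (m 1).choose b) •
            (completeEmptyClass a b * completeClass (m 0 - a + (m 1 - b))) := by
  rw [MvPowerSeries.coeff_mul]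
  simp only [coeff_completeEmptySeries, coeff_subst_permutohedronSeries]
  rw [sum_antidiagonal_fin_two m fun a b c d =>
    ((((a ! : ℚ)⁻¹ * (b ! : ℚ)⁻¹) • completeEmptyClass a b) *
      (((c ! : ℚ)⁻¹ * (d ! : ℚ)⁻¹) • completeClass (c + d)) : PolytopeRing), Finset.smul_sum]
  refine Finset.sum_congr rfl fun a ha => ?_
  rw [Finset.smul_sum]
  refine Finset.sum_congr rfl fun b hb => ?_
  rw [smul_mul_smul_comm, ← Nat.cast_smul_eq_nsmul ℚ, smul_smul]
  congr 1
  rw [Nat.cast_mul, Nat.cast_choose ℚ (Nat.lt_succ_iff.1 (Finset.mem_range.1 ha)),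
    Nat.cast_choose ℚ (Nat.lt_succ_iff.1 (Finset.mem_range.1 hb))]
  have h0 : ((m 0)! : ℚ) ≠ 0 := Nat.cast_ne_zero.2 (Nat.factorial_ne_zero _)
  have h1 : ((m 1)! : ℚ) ≠ 0 := Nat.cast_ne_zero.2 (Nat.factorial_ne_zero _)
  field_simp

/-- Extends the facet formula to `k = 0`, where every class involved is zero by convention, so that
coefficients can be compared without a case split. -/
theorem boundary_completeEmptyClass (k l : ℕ) :
    boundary (completeEmptyClass k l) = l • completeEmptyClass k (l - 1) +
      ∑ a ∈ Finset.range (k + 1), ∑ b ∈ Finset.range (l + 1),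
        (k.choose a * l.choose b) •
          (completeEmptyClass a b * completeClass (k - a + (l - b))) := by
  by_cases hk : 1 ≤ k
  · rw [← facetSum_completeEmptyNestohedron hk, ← boundary_cls, completeEmptyClass, if_pos hk]
  · obtain rfl : k = 0 := by omega
    simp [completeEmptyClass]

theorem mainTheorem6 :
    (∀ k l : ℕ, 1 ≤ k → (completeEmptyNestohedron k l).IsSimple) ∧
    (∀ n : ℕ, (permutohedron n).IsSimple) ∧
    boundarySeries completeEmptySeries =
      completeEmptySeries * (MvPowerSeries.X 1 +
        PowerSeries.subst (MvPowerSeries.X 0 + MvPowerSeries.X 1 :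
          MvPowerSeries (Fin 2) PolytopeRing) permutohedronSeries) := by
  refine ⟨fun k l hk => isSimple_completeEmptyNestohedron hk, isSimple_permutohedron, ?_⟩
  ext1 m
  rw [mul_add, map_add, coeff_completeEmptySeries_mul_X, coeff_completeEmptySeries_mul_subst,
    ← smul_add, ← boundary_completeEmptyClass]
  change boundary (MvPowerSeries.coeff m completeEmptySeries) = _
  rw [coeff_completeEmptySeries, Derivation.map_smul]
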